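/- Let $0<\alpha_0\le\beta_0$. There are constants $c_1,c_2>0$, depending only on $\alpha_0,\beta_0$, with the following property. Let $\mathbf x[1],\dots,\mathbf x[N]\in\mathbb R^d$ be jointly Gaussian with zero mean and $\mathrm E\{\mathbf x[n]\mathbf x^T[n']\}=\delta_{n,n'}\mathbf C[n]$, where all eigenvalues of $\mathbf C[n]$ lie in $[\alpha[n],\beta[n]]$ and $\alpha_0\le\alpha[n]\le\beta[n]\le\beta_0$. Put $\mathbf K[n]=\mathbf C[n]^{-1}$. Let $\mathcal G=(\{1,\dots,d\},\mathcal E)$ be the conditional independence graph of the process: distinct nodes $a,b$ are non-adjacent iff the component processes $(x_a[n])_{n=1}^N$ and $(x_b[n])_{n=1}^N$ are conditionally independent given all the other component processes. Let $s\ge1$ be an integer, $0<\delta<1$, $\rho_{\min}>0$, $\kappa>0$, and assume (i) $\rho_{a,b}:=\frac1N\sum_{n=1}^N\alpha[n]\big(\mathbf K[n]_{a,b}/\mathbf K[n]_{a,a}\big)^2\ge\rho_{\min}$ for all $(a,b)\in\mathcal E$ (and, if $\mathcal E=\emptyset$, $\rho_{\min}\le\frac1N\sum_n\beta[n]$); (ii)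 every node of $\mathcal G$ has at most $s$ neighbors; (iii) $\|\mathbf C[n_1]-\mathbf C[n_2]\|_\infty\le\kappa\,|n_2-n_1|/N$ for all $n_1,n_2$, where $\|\mathbf A\|_\infty=\max_i\sum_j|A_{i,j}|$; (iv) $\kappa s^{7/2}\ge\rho_{\min}^3$ (which can always be achieved by enlarging $\kappa$). Let $Q=\log\frac{\kappa s^{7/2}}{\delta\rho_{\min}^3}+s\log d$, let $L=\big\lceil c_2\frac{s^2}{\rho_{\min}^2}Q\big\rceil$, and suppose that $N$ is a multiple of $L$ and $$N\ \ge\ c_1\max\{1,\kappa\}\,\frac{s^{5/2}}{\rho_{\min}^3}\,Q .$$ For $b=1,\dots,B=N/L$ let $\widehat{\mathbf C}[b]=\frac1L\sum_{n=(b-1)L+1}^{bL}\mathbf x[n]\mathbf x^T[n]$; for a node $r$ and a set $\mathcal T\not\ni r$ of nodes let $$\widehat V_r(\mathcal T)=\frac1B\sum_{b=1}^B\frac1{\big((\widehat{\mathbf C}[b]_{\mathcal T',\mathcal T'})^{-1}\big)_{r,r}},\qquad \mathcal T'=\{r\}\cup\mathcal T .$$ The algorithm chooses for each node $r$ a minimizer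 $\widehat{\mathcal N}(r)$ of $\widehat V_r(\mathcal T)+\rho_{\min}|\mathcal T|$ over all $\mathcal T\not\ni r$ with $|\mathcal T|\le s$, and outputs the graph $\widehat{\mathcal G}$ in which distinct $i,j$ are adjacent iff $j\in\widehat{\mathcal N}(i)$ or $i\in\widehat{\mathcal N}(j)$ (OR rule), respectively iff $j\in\widehat{\mathcal N}(i)$ and $i\in\widehat{\mathcal N}(j)$ (AND rule). Then, for either rule and however ties between minimizers are broken, $\mathrm P\{\widehat{\mathcal G}=\mathcal G\}\ge1-\delta$. -/

import Mathlib

open MeasureTheory ProbabilityTheory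

/-- Conditional independence, under the law `P` of a process `x` of length `N` with `d` components,
of the component processes `x_a[·]` and `x_b[·]`, given the component processes with index in
`S`. A sample path `x` is stored as `x n i`, with time `n` and component `i`. -/
def ComponentsCondIndep {N d : ℕ} (P : Measure (Fin N → Fin d → ℝ)) [IsFiniteMeasure P]
    (S : Set (Fin d)) (a b : Fin d) : Prop :=
  have hS : Measurable (fun (x : Fin N → Fin d → ℝ) (c : S) (n : Fin N) => x n c) := by
    fun_prop
  CondIndepFun (MeasurableSpace.comap
      (fun (x : Fin N → Fin d → ℝ) (c : S) (n : Fin N) => x n c) inferInstance) hS.comap_le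
    (fun x n => x n a) (fun x n => x n b) P

/-- The conditional independence graph of a process with law `P`: distinct nodes `a`, `b` are
non-adjacent iff `x_a[·]` and `x_b[·]` are conditionally independent given all the other
component processes. -/
def condIndepGraph {N d : ℕ} (P : Measure (Fin N → Fin d → ℝ)) [IsFiniteMeasure P] :
    SimpleGraph (Fin d) where
  Adj a b := a ≠ b ∧ ¬ ComponentsCondIndep P ({a, b}ᶜ) a b
  symm := ⟨fun a b h => ⟨h.1.symm, fun h' => h.2 (by
    rw [Set.pair_comm] at h'
    exact CondIndepFun.symm h')⟩⟩
  loopless := ⟨fun _ h => h.1 rfl⟩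

/-- The matrix norm `‖A‖_∞ = max_i ∑_j |A i j|`. -/
noncomputable def maxRowSum {d : ℕ} (A : Matrix (Fin d) (Fin d) ℝ) : ℝ :=
  ⨆ i, ∑ j, |A i j|

/-- The partial correlation `ρ_{a,b} = (1/N) ∑_n α[n] (K[n]_{a,b} / K[n]_{a,a})²`, where
`K[n] = C[n]⁻¹`. -/
noncomputable def partialCorr {N d : ℕ} (α : Fin N → ℝ)
    (C : Fin N → Matrix (Fin d) (Fin d) ℝ) (a b : Fin d) : ℝ :=
  (1 / (N : ℝ)) * ∑ n, α n * ((C n)⁻¹ a b / (C n)⁻¹ a a) ^ 2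

/-- The sample covariance matrix of the block `{b L, …, b L + L - 1}` (counting from `0`). -/
noncomputable def blockSampleCov {N d : ℕ} (L : ℕ) (x : Fin N → Fin d → ℝ) (b : ℕ) :
    Matrix (Fin d) (Fin d) ℝ :=
  Matrix.of fun i j => (1 / (L : ℝ)) * ∑ n : Fin N with n.val / L = b, x n i * x n j

/-- The estimate of the conditional variance of `x_r[·]` given the components in `T`: the average,
over the `B = N / L` blocks `b`, of `1 / ((Ĉ[b]_{T',T'})⁻¹)_{r,r}`, with `T' = {r} ∪ T`. -/
noncomputable def condVarEst {N d : ℕ} (L : ℕ) (x : Fin N → Fin d → ℝ) (r : Fin d)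
    (T : Finset (Fin d)) : ℝ :=
  (1 / ((N / L : ℕ) : ℝ)) * ∑ b ∈ Finset.range (N / L),
    1 / ((blockSampleCov L x b).submatrix
        (Subtype.val : ↥(insert r T) → Fin d) (Subtype.val : ↥(insert r T) → Fin d))⁻¹
      ⟨r, Finset.mem_insert_self r T⟩ ⟨r, Finset.mem_insert_self r T⟩

/-- The sets of at most `s` nodes that do not contain `r`. -/
def candidateSets {d : ℕ} (s : ℕ) (r : Fin d) : Set (Finset (Fin d)) :=
  {T | r ∉ T ∧ T.card ≤ s}

/-- `T` is a minimizer, over the sets of at most `s` nodes that do not contain `r`, of the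
estimated conditional variance penalized by `ρ |T|`. -/
def IsNeighborhoodEstimate {N d : ℕ} (s L : ℕ) (ρ : ℝ) (x : Fin N → Fin d → ℝ) (r : Fin d)
    (T : Finset (Fin d)) : Prop :=
  T ∈ candidateSets s r ∧
    ∀ T' ∈ candidateSets s r, condVarEst L x r T + T.card * ρ ≤ condVarEst L x r T' + T'.card * ρ

/-- The two rules for combining the estimated neighborhoods. -/
inductive CombineRule
  | orRule
  | andRule

/-- The graph that a rule makes of a family of estimated neighborhoods. -/
def CombineRule.graph {d : ℕ} : CombineRule → (Fin d → Finset (Fin d)) → SimpleGraph (Fin d)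
  | .orRule, Nh => SimpleGraph.fromRel fun i j => j ∈ Nh i
  | .andRule, Nh =>
    { Adj := fun i j => i ≠ j ∧ j ∈ Nh i ∧ i ∈ Nh j
      symm := ⟨fun _ _ h => ⟨h.1.symm, h.2.2, h.2.1⟩⟩
      loopless := ⟨fun _ h => h.1 rfl⟩ }

/-- `H` is a possible output of the graphical model selection method on the data `x`, with
sparsity `s`, blocklength `L` and penalty `ρ`: ties between minimizers may be broken in any
way. -/
def IsGMSOutput {N d : ℕ} (rule : CombineRule) (s L : ℕ) (ρ : ℝ) (x : Fin N → Fin d → ℝ)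
    (H : SimpleGraph (Fin d)) : Prop :=
  ∃ Nh : Fin d → Finset (Fin d),
    (∀ r, IsNeighborhoodEstimate s L ρ x r (Nh r)) ∧ H = rule.graph Nh

/-- The factor `log (κ s^(7/2) / (δ ρ³)) + s log d` of the sample size and of the blocklength. -/
noncomputable def complexityFactor (d s : ℕ) (κ ρ δ : ℝ) : ℝ :=
  Real.log (κ * (s : ℝ) ^ (7 / 2 : ℝ) / (δ * ρ ^ 3)) + s * Real.log d

/-! Fix a node r with neighborhood 𝒩 and let p[n] be row r of K[n] divided by K[n]_{r,r}. Then
C[n]p[n] is a multiple of e_r, so the residual series p·x is independent of all components except r,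
and x_r = p·x + a·x with a = e_r - p. Conditional independence forces K[n]_{r,j} = 0
(`inv_apply_eq_zero_of_condIndep`), so a is supported in 𝒩.

Almost surely N·V̂_r(T) is the squared distance from the column x_r to the span U_T of the data in T
with separate coefficients in each block, a space of dimension at most (N/L)|T|. For 𝒩, inserting
the coefficients p at the first time of each block bounds N·V̂_r(𝒩) above by ‖p·x‖² plus a small
drift error, because regression vectors are stable when C varies slowly
(`QuadBounded.regression_sub_le`). For another set T, N·V̂_r(T) is at least ‖p·x‖² + w², up to a
cross term linear in w and the energy of p·x inside U_T; here w is the distance from a·x to U_T. The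
main term ‖p·x‖² and its fluctuations cancel in the comparison.

If T misses m neighbors, w² is close to the total excess variance E of a·x given the components in
T. Assumption (i) alone would give E ≥ Nmρ, which the penalty can consume entirely. The decisive
point is the sharper E ≥ Nmρ + E²/(Nβ) (`QuadBounded.excess`, `sum_excess`): the surplus, at least
Nρ²/β, pays for all errors. With confidence level q this needs q ≲ ρ³N (to absorb fluctuations of
size √(qE)), (N/L)s ≲ ρ²N (dimension of U_T, hence the blocklength) and a drift of order at most ρ².
If T strictly contains 𝒩, the errors only have to stay below the additional penalty Nρ. The two
accountings are `margin_of_missing` and `margin_of_superset`.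

All tail bounds are Chernoff bounds for p·x with the independent components frozen
(`measure_le_of_conditional`). One comparison fails with probability at most 7·exp(-q)
(`selection_error_le`); with q = 6Q a union bound over the nodes r and the sets T finishes the
proof. On the good event 𝒩 is the unique minimizer at every node, so neither ties nor the
combination rule matter. -/

/-! ### Quadratic forms: regression vectors, excess variance and stability. -/

section QuadraticForms

open Matrix

variable {ι : Type*} [Fintype ι]

/-- A symmetric matrix whose quadratic form lies between `a` and `b` times the squared norm. -/
structure QuadBounded (C : Matrix ι ι ℝ) (a b : ℝ) : Prop where
  symm : C.IsSymm
  lower : ∀ v : ι → ℝ, a * (v ⬝ᵥ v) ≤ v ⬝ᵥ C *ᵥ v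
  upper : ∀ v : ι → ℝ, v ⬝ᵥ C *ᵥ v ≤ b * (v ⬝ᵥ v)

theorem Matrix.IsSymm.dotProduct_mulVec_comm {C : Matrix ι ι ℝ} (hC : C.IsSymm) (v w : ι → ℝ) :
    v ⬝ᵥ C *ᵥ w = w ⬝ᵥ C *ᵥ v := by
  rw [Matrix.dotProduct_mulVec, ← Matrix.mulVec_transpose, hC.eq, dotProduct_comm]

theorem QuadBounded.of_spectrum [DecidableEq ι] {C : Matrix ι ι ℝ} {a b : ℝ} (hC : C.IsSymm)
    (h : spectrum ℝ C ⊆ Set.Icc a b) : QuadBounded C a b := by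
  have hH : C.IsHermitian := by simpa [Matrix.IsHermitian, Matrix.IsSymm] using hC
  have hone : ∀ c : ℝ, (c • (1 : Matrix ι ι ℝ)).IsHermitian := fun c => by
    simp [Matrix.IsHermitian]
  have h1 : (C - a • (1 : Matrix ι ι ℝ)).PosSemidef := by
    rw [Matrix.posSemidef_iff_isHermitian_and_spectrum_nonneg]
    refine ⟨hH.sub (hone a), fun x hx => ?_⟩
    have : x + a ∈ spectrum ℝ C := by
      have := spectrum.add_mem_add_iff (a := C - a • (1 : Matrix ι ι ℝ)) (r := x) (s := a)
      rw [Algebra.algebraMap_eq_smul_one] at this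
      simpa [add_comm] using this.2 hx
    have := (h this).1
    simp only [Set.mem_ofPred_eq]; linarith
  have h2 : (b • (1 : Matrix ι ι ℝ) - C).PosSemidef := by
    rw [Matrix.posSemidef_iff_isHermitian_and_spectrum_nonneg]
    refine ⟨(hone b).sub hH, fun x hx => ?_⟩
    have : b - x ∈ spectrum ℝ C := by
      have h3 : b • (1 : Matrix ι ι ℝ) - C = algebraMap ℝ _ b - C := by
        rw [Algebra.algebraMap_eq_smul_one]
      rw [h3] at hx
      rw [spectrum.mem_iff] at hx ⊢
      intro h4; apply hx
      have : algebraMap ℝ (Matrix ι ι ℝ) x - (algebraMap ℝ (Matrix ι ι ℝ) b - C)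
        = -(algebraMap ℝ (Matrix ι ι ℝ) (b - x) - C) := by
        rw [map_sub]; abel
      rw [this]; exact h4.neg
    have := (h this).2
    simp only [Set.mem_ofPred_eq]; linarith
  refine ⟨hC, fun v => ?_, fun v => ?_⟩
  · have := h1.dotProduct_mulVec_nonneg v
    simp [Matrix.sub_mulVec, Matrix.smul_mulVec, dotProduct_sub] at this
    linarith
  · have := h2.dotProduct_mulVec_nonneg v
    simp [Matrix.sub_mulVec, Matrix.smul_mulVec, dotProduct_sub] at this
    linarith

theorem dotProduct_self_eq_sum_sq (v : ι → ℝ) : v ⬝ᵥ v = ∑ i, v i ^ 2 := by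
  simp [dotProduct, sq]

theorem dotProduct_self_pos {v : ι → ℝ} (hv : v ≠ 0) : 0 < v ⬝ᵥ v := by
  rw [dotProduct_self_eq_sum_sq]
  obtain ⟨i, hi⟩ := Function.ne_iff.1 hv
  exact Finset.sum_pos' (fun i _ => sq_nonneg _) ⟨i, Finset.mem_univ _, by
    have : v i ≠ 0 := hi
    positivity⟩

namespace QuadBounded

variable {C : Matrix ι ι ℝ} {a b : ℝ}

theorem pos (h : QuadBounded C a b) (ha : 0 < a) {v : ι → ℝ} (hv : v ≠ 0) :
    0 < v ⬝ᵥ C *ᵥ v :=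
  (mul_pos ha (dotProduct_self_pos hv)).trans_le (h.lower v)

theorem nonneg (h : QuadBounded C a b) (ha : 0 < a) (v : ι → ℝ) : 0 ≤ v ⬝ᵥ C *ᵥ v :=
  (mul_nonneg ha.le (by rw [dotProduct_self_eq_sum_sq]; positivity)).trans (h.lower v)

theorem isUnit_det [DecidableEq ι] (h : QuadBounded C a b) (ha : 0 < a) : IsUnit C.det := by
  rw [isUnit_iff_ne_zero]
  intro h0
  obtain ⟨v, hv, hv0⟩ := Matrix.exists_mulVec_eq_zero_iff.2 h0
  have := h.pos ha hv
  simp [hv0] at this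

/-- The vector that annihilates, in the form `C`, all coordinates in `T`, obtained from `w` by
subtracting a vector supported in `T`. -/
theorem exists_regression [DecidableEq ι] (h : QuadBounded C a b) (ha : 0 < a) (T : Finset ι)
    (w : ι → ℝ) :
    ∃ g : ι → ℝ, (∀ i ∉ T, g i = 0) ∧ ∀ j ∈ T, (C *ᵥ (w - g)) j = 0 := by
  let D : Matrix T T ℝ := C.submatrix Subtype.val Subtype.val
  let ext : (T → ℝ) → ι → ℝ := fun c i => if hi : i ∈ T then c ⟨i, hi⟩ else 0
  have hext : ∀ c j, (hj : j ∈ T) → (C *ᵥ ext c) j = (D *ᵥ c) ⟨j, hj⟩ := by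
    intro c j hj
    simp only [Matrix.mulVec, dotProduct, D, Matrix.submatrix_apply]
    rw [← Finset.sum_subset (Finset.subset_univ T) (fun i _ hi => by simp [ext, hi]),
      ← Finset.sum_coe_sort T]
    exact Finset.sum_congr rfl fun i _ => by simp [ext]
  have hdet : IsUnit D.det := by
    rw [isUnit_iff_ne_zero]
    intro h0
    obtain ⟨c, hc, hc0⟩ := Matrix.exists_mulVec_eq_zero_iff.2 h0
    have hne : ext c ≠ 0 := fun h1 => hc (funext fun i => by
      have := congrFun h1 i
      simpa [ext] using this)
    have h2 := h.pos ha hne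
    have h3 : ext c ⬝ᵥ C *ᵥ ext c = 0 := by
      refine Finset.sum_eq_zero fun j _ => ?_
      by_cases hj : j ∈ T
      · rw [hext c j hj, hc0]; simp
      · simp [ext, hj]
    exact h2.ne' h3
  refine ⟨ext (D⁻¹ *ᵥ fun j => (C *ᵥ w) j), fun i hi => by simp [ext, hi], fun j hj => ?_⟩
  rw [Matrix.mulVec_sub, Pi.sub_apply, hext _ j hj, Matrix.mulVec_mulVec,
    Matrix.mul_nonsing_inv _ hdet, Matrix.one_mulVec, sub_self]

theorem diag_le [DecidableEq ι] (h : QuadBounded C a b) (r : ι) : C r r ≤ b := by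
  have := h.upper (Pi.single r 1)
  simpa using this

/-- If `w` is the regression vector of coordinate `r` on the other ones, then the part of `w`
that is not explained by `T` has a variance exceeding `a` times its squared coefficients by a
quadratic term. -/
theorem excess [DecidableEq ι] (h : QuadBounded C a b) (ha : 0 < a) (hb : 0 < b) {T M : Finset ι}
    {r : ι} (hrT : r ∉ T) (hM : Disjoint M T) {p g : ι → ℝ} {v₀ : ℝ} (hpr : p r = 1)
    (hp : C *ᵥ p = Pi.single r v₀) (hg : ∀ i ∉ T, g i = 0)
    (hgT : ∀ j ∈ T, (C *ᵥ (Pi.single r 1 - p - g)) j = 0) :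
    a * ∑ j ∈ M, (if j = r then 0 else p j ^ 2) +
      ((Pi.single r 1 - p - g) ⬝ᵥ C *ᵥ (Pi.single r 1 - p - g)) ^ 2 / b ≤
      (Pi.single r 1 - p - g) ⬝ᵥ C *ᵥ (Pi.single r 1 - p - g) := by
  set w := Pi.single r 1 - p - g with hw
  set e := w ⬝ᵥ C *ᵥ w with he
  have hwr : w r = 0 := by simp [hw, hpr, hg r hrT]
  -- Since e_r = w + p + g, and both p and g are C-orthogonal to w, pairing e_r with Cw leaves only
  -- the form of w.
  have hCwr : (C *ᵥ w) r = e := by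
    have h1 : (Pi.single r 1 : ι → ℝ) ⬝ᵥ C *ᵥ w = (C *ᵥ w) r := by simp
    have h2 : (Pi.single r 1 : ι → ℝ) = w + p + g := by rw [hw]; abel
    have h3 : p ⬝ᵥ C *ᵥ w = 0 := by
      rw [h.symm.dotProduct_mulVec_comm, hp]; simp [hwr]
    have h4 : g ⬝ᵥ C *ᵥ w = 0 := by
      refine Finset.sum_eq_zero fun j _ => ?_
      by_cases hj : j ∈ T
      · rw [hgT j hj, mul_zero]
      · rw [hg j hj, zero_mul]
    rw [← h1, h2, add_dotProduct, add_dotProduct, h3, h4, ← he]; ring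
  have hsum : ∑ j ∈ M, (if j = r then 0 else p j ^ 2) ≤ w ⬝ᵥ w := by
    rw [dotProduct_self_eq_sum_sq]
    refine (Finset.sum_le_sum fun j hj => ?_).trans
      (Finset.sum_le_univ_sum_of_nonneg (s := M) fun j => sq_nonneg (w j))
    split_ifs with hjr
    · positivity
    · rw [hw]; simp [hjr, hg j (Finset.disjoint_left.1 hM hj)]
  have hCrr := h.diag_le r
  -- Moving w along e_r cannot shorten it, because w vanishes at r, but lowers the form. This t
  -- minimizes e + 2te + t²b, and the decrease e²/b is the quadratic surplus.
  set t := - e / b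
  have hq := h.lower (w + Pi.single r t)
  have hexp : (w + Pi.single r t) ⬝ᵥ C *ᵥ (w + Pi.single r t) = e + 2 * t * e + t ^ 2 * C r r := by
    have h1 : (Pi.single r t : ι → ℝ) ⬝ᵥ C *ᵥ w = t * e := by simp [hCwr]
    have h2 : w ⬝ᵥ C *ᵥ (Pi.single r t) = t * e := by rw [h.symm.dotProduct_mulVec_comm, h1]
    rw [Matrix.mulVec_add, add_dotProduct, dotProduct_add, dotProduct_add, h1, h2, ← he]
    simp; ring
  have hnorm : w ⬝ᵥ w ≤ (w + Pi.single r t) ⬝ᵥ (w + Pi.single r t) := by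
    rw [add_dotProduct, dotProduct_add, dotProduct_add]
    simp [hwr]; nlinarith [sq_nonneg t]
  have h5 : a * ∑ j ∈ M, (if j = r then 0 else p j ^ 2) ≤ e + 2 * t * e + t ^ 2 * b := by
    have := mul_le_mul_of_nonneg_left (hsum.trans hnorm) ha.le
    nlinarith [sq_nonneg t]
  have h6 : e + 2 * t * e + t ^ 2 * b = e - e ^ 2 / b := by
    simp only [t]; field_simp; ring
  linarith

theorem excess_le {b e A : ℝ} (hb : 0 < b) (hA : 0 ≤ A) (h : A + e ^ 2 / b ≤ e) : e ≤ b := by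
  by_contra hlt
  push Not at hlt
  have : e < e ^ 2 / b := by rw [lt_div_iff₀ hb]; nlinarith
  linarith

end QuadBounded

/-- Schur test: for a symmetric matrix the row sums also bound the column sums, and a weighted
arithmetic-geometric mean inequality separates the two vectors. The weight t is left free so that
one of the two terms can be absorbed. -/
theorem abs_dotProduct_mulVec_le [DecidableEq ι] {D : Matrix ι ι ℝ} (hD : D.IsSymm) {η t : ℝ}
    (h : ∀ i, ∑ j, |D i j| ≤ η) (ht : 0 < t) (u w : ι → ℝ) :
    |u ⬝ᵥ D *ᵥ w| ≤ η / 2 * (t * (u ⬝ᵥ u) + (w ⬝ᵥ w) / t) := by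
  have key : ∀ x y : ℝ, |x| * |y| ≤ (t * x ^ 2 + y ^ 2 / t) / 2 := by
    intro x y
    have h1 : t * x ^ 2 + y ^ 2 / t - 2 * (|x| * |y|) = (t * |x| - |y|) ^ 2 / t := by
      rw [← sq_abs x, ← sq_abs y]; field_simp; ring
    have h2 : 0 ≤ (t * |x| - |y|) ^ 2 / t := by positivity
    linarith
  have h1 : |u ⬝ᵥ D *ᵥ w| ≤ ∑ i, ∑ j, |D i j| * ((t * u i ^ 2 + w j ^ 2 / t) / 2) := by
    simp only [dotProduct, Matrix.mulVec, Finset.mul_sum]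
    refine (Finset.abs_sum_le_sum_abs _ _).trans (Finset.sum_le_sum fun i _ => ?_)
    refine (Finset.abs_sum_le_sum_abs _ _).trans (Finset.sum_le_sum fun j _ => ?_)
    rw [abs_mul, abs_mul]
    nlinarith [key (u i) (w j), abs_nonneg (D i j)]
  refine h1.trans ?_
  have h2 : ∑ i, ∑ j, |D i j| * ((t * u i ^ 2 + w j ^ 2 / t) / 2) =
      ∑ i, (∑ j, |D i j|) * (t * u i ^ 2 / 2) + ∑ j, (∑ i, |D j i|) * (w j ^ 2 / t / 2) := by
    have : ∑ j, (∑ i, |D j i|) * (w j ^ 2 / t / 2) = ∑ i, ∑ j, |D i j| * (w j ^ 2 / t / 2) := by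
      rw [Finset.sum_comm]
      refine Finset.sum_congr rfl fun j _ => ?_
      rw [Finset.sum_mul]
      exact Finset.sum_congr rfl fun i _ => by rw [hD.apply]
    rw [this, ← Finset.sum_add_distrib]
    refine Finset.sum_congr rfl fun i _ => ?_
    rw [Finset.sum_mul, ← Finset.sum_add_distrib]
    exact Finset.sum_congr rfl fun j _ => by ring
  rw [h2, dotProduct_self_eq_sum_sq, dotProduct_self_eq_sum_sq]
  calc _ ≤ ∑ i, η * (t * u i ^ 2 / 2) + ∑ j, η * (w j ^ 2 / t / 2) := by
        gcongr
        · exact h _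
        · exact h _
    _ = _ := by
        rw [← Finset.mul_sum, ← Finset.mul_sum, ← Finset.sum_div, ← Finset.sum_div,
          ← Finset.mul_sum, ← Finset.sum_div]
        ring

/-- The residual variance is v₀, and C r r - v₀ is the form evaluated at the regression vector,
hence nonnegative. -/
theorem QuadBounded.regression_norm_le [DecidableEq ι] {C : Matrix ι ι ℝ} {a b : ℝ}
    (h : QuadBounded C a b) (ha : 0 < a) {r : ι} {p : ι → ℝ} {v₀ : ℝ} (hpr : p r = 1)
    (hp : C *ᵥ p = Pi.single r v₀) :
    v₀ = p ⬝ᵥ C *ᵥ p ∧ v₀ ≤ b ∧ a * (p ⬝ᵥ p) ≤ b := by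
  have h0 : p ⬝ᵥ C *ᵥ p = v₀ := by rw [hp]; simp [hpr]
  have h1 : (Pi.single r 1 - p) ⬝ᵥ C *ᵥ (Pi.single r 1 - p) = C r r - v₀ := by
    have h2 : p ⬝ᵥ C *ᵥ (Pi.single r 1 : ι → ℝ) = v₀ := by
      rw [h.symm.dotProduct_mulVec_comm, hp]; simp
    rw [Matrix.mulVec_sub, dotProduct_sub, sub_dotProduct, sub_dotProduct, h0, h2, hp]
    simp
  have h2 := h.nonneg ha (Pi.single r 1 - p)
  have h3 := h.diag_le r
  have h4 := h.lower p
  refine ⟨h0.symm, by linarith, by linarith⟩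

/-- Stability of the regression vector under a perturbation of the covariance matrix. -/
theorem QuadBounded.regression_sub_le [DecidableEq ι] {C C' : Matrix ι ι ℝ} {a b η : ℝ}
    (h : QuadBounded C a b) (h' : QuadBounded C' a b) (ha : 0 < a) (hη : 0 < η)
    (hD : ∀ i, ∑ j, |(C - C') i j| ≤ η) {r : ι} {p p' : ι → ℝ} {v₀ v₀' : ℝ} (hpr : p r = 1)
    (hpr' : p' r = 1) (hp : C *ᵥ p = Pi.single r v₀) (hp' : C' *ᵥ p' = Pi.single r v₀') :
    (p - p') ⬝ᵥ (p - p') ≤ η ^ 2 * b / a ^ 3 := by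
  have hΔ : (p - p') r = 0 := by simp [hpr, hpr']
  have h1 : C *ᵥ (p - p') = Pi.single r v₀ - Pi.single r v₀' - (C - C') *ᵥ p' := by
    rw [Matrix.mulVec_sub, hp, Matrix.sub_mulVec, hp']; abel
  have h2 : (p - p') ⬝ᵥ C *ᵥ (p - p') = -((p - p') ⬝ᵥ (C - C') *ᵥ p') := by
    rw [h1, dotProduct_sub, dotProduct_sub]
    simp only [dotProduct_single, hΔ]; ring
  -- The weight a/η makes the term in p - p' exactly half of the coercive lower bound, so that it
  -- can be absorbed.
  have h3 := abs_dotProduct_mulVec_le (h.symm.sub h'.symm) hD (t := a / η) (by positivity)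
    (p - p') p'
  have h4 := h.lower (p - p')
  have h5 := neg_abs_le ((p - p') ⬝ᵥ (C - C') *ᵥ p')
  have h6 : η / 2 * (a / η * ((p - p') ⬝ᵥ (p - p')) + p' ⬝ᵥ p' / (a / η)) =
      a / 2 * ((p - p') ⬝ᵥ (p - p')) + η ^ 2 / (2 * a) * (p' ⬝ᵥ p') := by
    field_simp
  have h7 := (h'.regression_norm_le ha hpr' hp').2.2
  have h8 : a / 2 * ((p - p') ⬝ᵥ (p - p')) ≤ η ^ 2 / (2 * a) * (p' ⬝ᵥ p') := by linarith
  have h9 : p' ⬝ᵥ p' ≤ b / a := by rw [le_div_iff₀ ha]; linarith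
  have h10 : a / 2 * ((p - p') ⬝ᵥ (p - p')) ≤ η ^ 2 / (2 * a) * (b / a) :=
    h8.trans (by gcongr)
  have h11 : η ^ 2 / (2 * a) * (b / a) = a / 2 * (η ^ 2 * b / a ^ 3) := by field_simp
  rw [h11] at h10
  exact le_of_mul_le_mul_left h10 (by positivity)

theorem QuadBounded.inv_diag_pos [DecidableEq ι] {C : Matrix ι ι ℝ} {a b : ℝ}
    (h : QuadBounded C a b) (ha : 0 < a) (r : ι) : 0 < C⁻¹ r r := by
  have hdet := h.isUnit_det ha
  have h1 : C *ᵥ (C⁻¹ *ᵥ Pi.single r 1) = Pi.single r 1 := by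
    rw [Matrix.mulVec_mulVec, Matrix.mul_nonsing_inv _ hdet, Matrix.one_mulVec]
  have h2 : C⁻¹ *ᵥ Pi.single r 1 ≠ 0 := fun h0 => by
    rw [h0, Matrix.mulVec_zero] at h1
    have := congrFun h1 r
    simp at this
  have h3 := h.pos ha h2
  rw [h1] at h3
  simpa using h3

/-- The coefficients `K_{r,j} / K_{r,r}` of the regression residual of coordinate `r`. -/
noncomputable def residualCoeff [DecidableEq ι] (C : Matrix ι ι ℝ) (r j : ι) : ℝ :=
  C⁻¹ r j / C⁻¹ r r

theorem QuadBounded.inv_isSymm [DecidableEq ι] {C : Matrix ι ι ℝ} {a b : ℝ}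
    (h : QuadBounded C a b) : (C⁻¹).IsSymm := by
  rw [Matrix.IsSymm, Matrix.transpose_nonsing_inv, h.symm.eq]

theorem QuadBounded.residualCoeff_self [DecidableEq ι] {C : Matrix ι ι ℝ} {a b : ℝ}
    (h : QuadBounded C a b) (ha : 0 < a) (r : ι) : residualCoeff C r r = 1 :=
  div_self (h.inv_diag_pos ha r).ne'

theorem QuadBounded.mulVec_residualCoeff [DecidableEq ι] {C : Matrix ι ι ℝ} {a b : ℝ}
    (h : QuadBounded C a b) (ha : 0 < a) (r : ι) :
    C *ᵥ residualCoeff C r = Pi.single r (1 / C⁻¹ r r) := by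
  have h1 : residualCoeff C r = C⁻¹ *ᵥ Pi.single r (1 / C⁻¹ r r) := by
    ext j
    simp [residualCoeff, h.inv_isSymm.apply r j, div_eq_mul_inv]
  rw [h1, Matrix.mulVec_mulVec, Matrix.mul_nonsing_inv _ (h.isUnit_det ha), Matrix.one_mulVec]

end QuadraticForms

/-! ### Chernoff bounds for vectors of independent centered Gaussians with unequal variances. -/

section GaussianTails

open scoped ENNReal NNReal

variable {ι : Type*} [Fintype ι]

/-- The law of a vector of independent centered Gaussian variables with variances `v`. -/
noncomputable def gaussianPi (v : ι → ℝ≥0) : Measure (ι → ℝ) :=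
  Measure.pi fun i => gaussianReal 0 (v i)

instance (v : ι → ℝ≥0) : IsProbabilityMeasure (gaussianPi v) := by
  unfold gaussianPi; infer_instance

theorem lintegral_gaussianPi_prod (v : ι → ℝ≥0) {f : ι → ℝ → ℝ≥0∞} (hf : ∀ i, Measurable (f i)) :
    ∫⁻ x, ∏ i, f i (x i) ∂gaussianPi v = ∏ i, ∫⁻ x, f i x ∂gaussianReal 0 (v i) := by
  have hind : iIndepFun (fun i (x : ι → ℝ) => f i (x i)) (gaussianPi v) :=
    iIndepFun_pi (X := fun i => f i) fun i => (hf i).aemeasurable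
  rw [lintegral_prod_eq_prod_lintegral_of_indepFun Finset.univ _ hind
    fun i => (hf i).comp (measurable_pi_apply i)]
  refine Finset.prod_congr rfl fun i _ => ?_
  have := (measurePreserving_eval (fun i => gaussianReal 0 (v i)) i)
  exact this.lintegral_comp (hf i)

theorem lintegral_exp_mul_gaussianReal (v : ℝ≥0) (t : ℝ) :
    ∫⁻ x, ENNReal.ofReal (Real.exp (t * x)) ∂gaussianReal 0 v =
      ENNReal.ofReal (Real.exp (v * t ^ 2 / 2)) := by
  rw [← ofReal_integral_eq_lintegral_ofReal (integrable_exp_mul_gaussianReal t)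
    (ae_of_all _ fun x => (Real.exp_pos _).le)]
  have := congrFun (mgf_id_gaussianReal (μ := 0) (v := v)) t
  simp only [mgf, id, zero_mul, zero_add] at this
  rw [this]

theorem lintegral_exp_sum_gaussianPi (v : ι → ℝ≥0) (c : ι → ℝ) :
    ∫⁻ x, ENNReal.ofReal (Real.exp (∑ i, c i * x i)) ∂gaussianPi v =
      ENNReal.ofReal (Real.exp (∑ i, v i * c i ^ 2 / 2)) := by
  simp_rw [Real.exp_sum, ENNReal.ofReal_prod_of_nonneg fun i _ => (Real.exp_pos _).le]
  rw [lintegral_gaussianPi_prod v (f := fun i x => ENNReal.ofReal (Real.exp (c i * x)))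
    fun i => by fun_prop]
  simp_rw [lintegral_exp_mul_gaussianReal]

theorem lintegral_exp_sq_gaussianReal (v : ℝ≥0) {t : ℝ} (ht : 2 * v * t < 1) :
    ∫⁻ x, ENNReal.ofReal (Real.exp (t * x ^ 2)) ∂gaussianReal 0 v =
      ENNReal.ofReal (√(1 / (1 - 2 * v * t))) := by
  rcases eq_or_ne v 0 with rfl | hv
  · simp [gaussianReal_zero_var]
  have hv0 : (0 : ℝ) < v := by positivity
  set b : ℝ := 1 / (2 * v) - t with hb
  have hb0 : 0 < b := by
    rw [hb, sub_pos, lt_div_iff₀ (by positivity)]; linarith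
  rw [gaussianReal_of_var_ne_zero 0 hv, lintegral_withDensity_eq_lintegral_mul _
    (measurable_gaussianPDF 0 v) (by fun_prop)]
  have h1 : ∀ x : ℝ, (gaussianPDF 0 v * fun x => ENNReal.ofReal (Real.exp (t * x ^ 2))) x =
      ENNReal.ofReal ((√(2 * Real.pi * v))⁻¹ * Real.exp (-b * x ^ 2)) := by
    intro x
    rw [Pi.mul_apply, gaussianPDF, ← ENNReal.ofReal_mul (gaussianPDFReal_nonneg _ _ _),
      gaussianPDFReal, mul_assoc, ← Real.exp_add]
    congr 3
    rw [hb]; field_simp; ring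
  simp_rw [h1]
  rw [← ofReal_integral_eq_lintegral_ofReal ((integrable_exp_neg_mul_sq hb0).const_mul _)
    (ae_of_all _ fun x => by positivity), integral_const_mul, integral_gaussian]
  congr 1
  rw [← Real.sqrt_inv, ← Real.sqrt_mul (by positivity)]
  congr 1
  have : 1 - 2 * v * t = 2 * v * b := by rw [hb]; field_simp
  rw [this]
  have := Real.pi_pos
  field_simp

theorem measure_le_of_lintegral_exp_le {α : Type*} [MeasurableSpace α] {μ : Measure α} {f : α → ℝ}
    (hf : Measurable f) {A t q : ℝ}
    (h : ∫⁻ x, ENNReal.ofReal (Real.exp (f x)) ∂μ ≤ ENNReal.ofReal (Real.exp A))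
    (hq : A - t ≤ -q) : μ {x | t < f x} ≤ ENNReal.ofReal (Real.exp (-q)) := by
  have h1 := mul_meas_ge_le_lintegral (μ := μ)
    (f := fun x => ENNReal.ofReal (Real.exp (f x))) (by fun_prop) (ENNReal.ofReal (Real.exp t))
  have h2 : μ {x | t < f x} ≤
      μ {x | ENNReal.ofReal (Real.exp t) ≤ ENNReal.ofReal (Real.exp (f x))} :=
    measure_mono fun x hx => ENNReal.ofReal_le_ofReal (Real.exp_le_exp.2 (le_of_lt hx))
  have h3 : ENNReal.ofReal (Real.exp t) * μ {x | t < f x} ≤ ENNReal.ofReal (Real.exp A) :=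
    (mul_le_mul_right h2 _).trans (h1.trans h)
  have h4 : μ {x | t < f x} =
      ENNReal.ofReal (Real.exp (-t)) * (ENNReal.ofReal (Real.exp t) * μ {x | t < f x}) := by
    rw [← mul_assoc, ← ENNReal.ofReal_mul (Real.exp_pos _).le, ← Real.exp_add]; simp
  rw [h4]
  refine (mul_le_mul_right h3 _).trans ?_
  rw [← ENNReal.ofReal_mul (Real.exp_pos _).le, ← Real.exp_add]
  exact ENNReal.ofReal_le_ofReal (Real.exp_le_exp.2 (by linarith))

variable {v : ι → ℝ≥0} {b q : ℝ}

theorem gaussianPi_linear_tail (hb : 0 < b) (hv : ∀ i, (v i : ℝ) ≤ b) (hq : 0 < q) (c : ι → ℝ) :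
    gaussianPi v {x | √(2 * b * q) * √(∑ i, c i ^ 2) < ∑ i, c i * x i} ≤
      ENNReal.ofReal (Real.exp (-q)) := by
  set s := √(∑ i, c i ^ 2) with hs
  have hs2 : s ^ 2 = ∑ i, c i ^ 2 := Real.sq_sqrt (Finset.sum_nonneg fun i _ => sq_nonneg _)
  rcases (Real.sqrt_nonneg (∑ i, c i ^ 2)).eq_or_lt with h0 | hpos
  · have hc : ∀ i, c i = 0 := by
      rw [← hs] at h0
      rw [← h0] at hs2
      intro i
      have := (Finset.sum_eq_zero_iff_of_nonneg fun i _ => sq_nonneg (c i)).1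
        (by rw [← hs2]; norm_num) i (Finset.mem_univ i)
      exact pow_eq_zero_iff two_ne_zero |>.1 this
    have : {x : ι → ℝ | √(2 * b * q) * s < ∑ i, c i * x i} = ∅ := by
      ext x
      rw [← hs] at h0
      simp [hc, ← h0]
    rw [this]; simp
  · rw [← hs] at hpos
    set w := √(2 * b * q) with hw
    have hw2 : w ^ 2 = 2 * b * q := Real.sq_sqrt (by positivity)
    have hw0 : 0 < w := Real.sqrt_pos.2 (by positivity)
    set l := w / (b * s) with hl
    have hl0 : 0 < l := by positivity
    have h1 := lintegral_exp_sum_gaussianPi v (fun i => l * c i)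
    have h2 : ∑ i, (v i : ℝ) * (l * c i) ^ 2 / 2 ≤ q := by
      calc _ ≤ ∑ i, b * (l * c i) ^ 2 / 2 := by gcongr; exact hv _
        _ = b * l ^ 2 * s ^ 2 / 2 := by
          rw [hs2, Finset.mul_sum, Finset.sum_div]
          exact Finset.sum_congr rfl fun i _ => by ring
        _ = q := by rw [hl, div_pow, hw2]; field_simp
    have h3 := measure_le_of_lintegral_exp_le (μ := gaussianPi v)
      (f := fun x => ∑ i, l * c i * x i) (t := 2 * q) (by fun_prop)
      (h1.le.trans (ENNReal.ofReal_le_ofReal (Real.exp_le_exp.2 h2))) (q := q) (by linarith)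
    refine (measure_mono fun x hx => ?_).trans h3
    simp only [Set.mem_ofPred_eq] at hx ⊢
    have h4 : 2 * q = l * (w * s) := by
      rw [hl]; field_simp; linarith
    rw [h4]
    calc _ < l * ∑ i, c i * x i := by gcongr
      _ = _ := by rw [Finset.mul_sum]; exact Finset.sum_congr rfl fun i _ => by ring

/-- The Laplace transform (1 + 2lv)^(-1/2) of a squared Gaussian is at most exp(-lv + l²v²), because
log(1 + y) ≥ y - y²/2. The deviation is expressed through the sum of the variances, not their
number, so it is small when the total variance is small. -/
theorem gaussianPi_sq_lower_tail (hb : 0 < b) (hv : ∀ i, (v i : ℝ) ≤ b) (hq : 0 < q) :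
    gaussianPi v {x | ∑ i, x i ^ 2 < ∑ i, (v i : ℝ) - 2 * √(q * b * ∑ i, (v i : ℝ))} ≤
      ENNReal.ofReal (Real.exp (-q)) := by
  set E := ∑ i, (v i : ℝ) with hE
  rcases (show 0 ≤ E from Finset.sum_nonneg fun i _ => (v i).2).eq_or_lt with h0 | hpos
  · have : {x : ι → ℝ | ∑ i, x i ^ 2 < E - 2 * √(q * b * E)} = ∅ := by
      ext x
      simp only [← h0, mul_zero, Real.sqrt_zero, sub_zero, Set.mem_ofPred_eq,
        Set.mem_empty_iff_false, iff_false, not_lt]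
      positivity
    rw [this]; simp
  · set w := √(q * b * E) with hw
    have hw2 : w ^ 2 = q * b * E := Real.sq_sqrt (by positivity)
    have hw0 : 0 < w := Real.sqrt_pos.2 (by positivity)
    -- The minimizer of -2lw + l²bE, since w² = qbE.
    set l := q / w with hl
    have hl0 : 0 < l := by positivity
    have hone : ∀ i, ∫⁻ x, ENNReal.ofReal (Real.exp (-l * x ^ 2)) ∂gaussianReal 0 (v i) ≤
        ENNReal.ofReal (Real.exp (-l * v i + l ^ 2 * v i ^ 2)) := by
      intro i
      have hlv : 0 ≤ l * v i := by positivity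
      rw [lintegral_exp_sq_gaussianReal (v i) (by nlinarith)]
      refine ENNReal.ofReal_le_ofReal ?_
      rw [Real.sqrt_le_left (Real.exp_pos _).le, ← Real.exp_nat_mul, one_div,
        ← Real.exp_log (show 0 < 1 - 2 * (v i : ℝ) * -l by nlinarith), ← Real.exp_neg,
        Real.exp_le_exp]
      set y := 2 * (l * v i) with hy
      have hy0 : 0 ≤ y := by positivity
      have h1 : 1 - 2 * (v i : ℝ) * -l = 1 + y := by rw [hy]; ring
      have h2 : y - y ^ 2 / 2 ≤ Real.log (1 + y) := by
        have := Real.le_log_one_add_of_nonneg hy0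
        refine le_trans ?_ this
        rw [le_div_iff₀ (by linarith)]
        nlinarith [pow_nonneg hy0 3]
      rw [h1]
      push_cast
      nlinarith
    have h1 : ∫⁻ x, ENNReal.ofReal (Real.exp (∑ i, -l * x i ^ 2)) ∂gaussianPi v ≤
        ENNReal.ofReal (Real.exp (-l * E + l ^ 2 * (b * E))) := by
      simp_rw [Real.exp_sum, ENNReal.ofReal_prod_of_nonneg fun i _ => (Real.exp_pos _).le]
      rw [lintegral_gaussianPi_prod v (f := fun i x => ENNReal.ofReal (Real.exp (-l * x ^ 2)))
        fun i => by fun_prop]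
      refine (Finset.prod_le_prod' fun i _ => hone i).trans ?_
      rw [← ENNReal.ofReal_prod_of_nonneg fun i _ => (Real.exp_pos _).le, ← Real.exp_sum]
      refine ENNReal.ofReal_le_ofReal (Real.exp_le_exp.2 ?_)
      rw [Finset.sum_add_distrib, ← Finset.mul_sum, ← Finset.mul_sum, ← hE]
      gcongr
      rw [hE, Finset.mul_sum]
      refine Finset.sum_le_sum fun i _ => ?_
      rw [sq]
      exact mul_le_mul_of_nonneg_right (hv i) (v i).2
    have hlw : l * w = q := by rw [hl]; field_simp
    have h3 := measure_le_of_lintegral_exp_le (μ := gaussianPi v)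
      (f := fun x => ∑ i, -l * x i ^ 2) (t := -l * (E - 2 * w)) (q := q) (by fun_prop) h1
      (by
        have : l ^ 2 * (b * E) = q := by
          have : b * E = w ^ 2 / q := by rw [hw2]; field_simp
          rw [this, hl]; field_simp
        rw [this]; nlinarith)
    refine (measure_mono fun x hx => ?_).trans h3
    simp only [Set.mem_ofPred_eq] at hx ⊢
    rw [← Finset.mul_sum]
    nlinarith

/-- With unequal variances the coordinates of the projection are dependent. The exponential of their
squares is therefore linearized by an auxiliary standard Gaussian vector g; after exchanging the
integrals, the integral over x is at most exp(‖g‖²/4) by orthonormality, and each coordinate of g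
contributes √2. -/
theorem lintegral_exp_projection_gaussianPi {k : ℕ} (hb : 0 < b) (hv : ∀ i, (v i : ℝ) ≤ b)
    (f : Fin k → EuclideanSpace ℝ ι) (hf : Orthonormal ℝ f) :
    ∫⁻ x, ENNReal.ofReal (Real.exp (∑ j, (∑ i, f j i * x i) ^ 2 / (4 * b))) ∂gaussianPi v ≤
      ENNReal.ofReal (√2 ^ k) := by
  set l := 1 / √(2 * b) with hl
  have hl2 : l ^ 2 = 1 / (2 * b) := by
    rw [hl, div_pow, Real.sq_sqrt (by positivity), one_pow]
  have hlin : ∀ y : Fin k → ℝ, ENNReal.ofReal (Real.exp (∑ j, y j ^ 2 / (4 * b))) =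
      ∫⁻ g, ENNReal.ofReal (Real.exp (∑ j, l * y j * g j)) ∂gaussianPi (fun _ : Fin k => 1) := by
    intro y
    rw [lintegral_exp_sum_gaussianPi]
    congr 3
    ext j
    rw [mul_pow, hl2]; push_cast; field_simp; ring
  simp_rw [hlin]
  rw [lintegral_lintegral_swap (by fun_prop)]
  have hin : ∀ g : Fin k → ℝ,
      ∫⁻ x, ENNReal.ofReal (Real.exp (∑ j, l * (∑ i, f j i * x i) * g j)) ∂gaussianPi v ≤
      ENNReal.ofReal (Real.exp (∑ j, 1 / 4 * g j ^ 2)) := by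
    intro g
    have h1 : ∀ x : ι → ℝ, ∑ j, l * (∑ i, f j i * x i) * g j =
        ∑ i, (l * ∑ j, g j * f j i) * x i := by
      intro x
      simp only [Finset.mul_sum, Finset.sum_mul]
      rw [Finset.sum_comm]
      exact Finset.sum_congr rfl fun i _ => Finset.sum_congr rfl fun j _ => by ring
    simp_rw [h1]
    rw [lintegral_exp_sum_gaussianPi]
    refine ENNReal.ofReal_le_ofReal (Real.exp_le_exp.2 ?_)
    have h2 : ∑ i, (∑ j, g j * f j i) ^ 2 = ∑ j, g j ^ 2 := by
      have h3 : ‖∑ j, g j • f j‖ ^ 2 = ∑ j, g j ^ 2 := by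
        rw [← real_inner_self_eq_norm_sq, hf.inner_sum]
        simp [sq]
      rw [EuclideanSpace.norm_sq_eq] at h3
      rw [← h3]
      refine Finset.sum_congr rfl fun i _ => ?_
      simp
    calc _ ≤ ∑ i, b * (l * ∑ j, g j * f j i) ^ 2 / 2 := by gcongr; exact hv _
      _ = b * l ^ 2 / 2 * ∑ i, (∑ j, g j * f j i) ^ 2 := by
        rw [Finset.mul_sum]; exact Finset.sum_congr rfl fun i _ => by ring
      _ = _ := by
        rw [h2, hl2, ← Finset.mul_sum]; field_simp; ring
  refine (lintegral_mono hin).trans ?_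
  simp_rw [Real.exp_sum, ENNReal.ofReal_prod_of_nonneg fun i _ => (Real.exp_pos _).le]
  rw [lintegral_gaussianPi_prod _
    (f := fun (_ : Fin k) x => ENNReal.ofReal (Real.exp (1 / 4 * x ^ 2))) fun i => by fun_prop]
  simp_rw [lintegral_exp_sq_gaussianReal 1 (t := 1 / 4) (by norm_num)]
  rw [Finset.prod_const, ← ENNReal.ofReal_pow (Real.sqrt_nonneg _)]
  norm_num

theorem gaussianPi_projection_tail (hb : 0 < b) (hv : ∀ i, (v i : ℝ) ≤ b)
    (U : Submodule ℝ (EuclideanSpace ℝ ι)) {K : ℝ} (hK : (Module.finrank ℝ U : ℝ) ≤ K) :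
    gaussianPi v {x | 4 * b * (K + q) < ‖U.starProjection (WithLp.toLp 2 x)‖ ^ 2} ≤
      ENNReal.ofReal (Real.exp (-q)) := by
  set k := Module.finrank ℝ U with hk
  let e := stdOrthonormalBasis ℝ U
  let f : Fin k → EuclideanSpace ℝ ι := fun j => (e j : EuclideanSpace ℝ ι)
  have hf : Orthonormal ℝ f := e.orthonormal.comp_linearIsometry U.subtypeₗᵢ
  have hnorm : ∀ x : ι → ℝ, ‖U.starProjection (WithLp.toLp 2 x)‖ ^ 2 =
      ∑ j, (∑ i, f j i * x i) ^ 2 := by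
    intro x
    rw [Submodule.starProjection_apply, ← Submodule.coe_norm, ← e.sum_sq_norm_inner_right]
    refine Finset.sum_congr rfl fun j _ => ?_
    rw [Submodule.inner_orthogonalProjectionOnto_eq_of_mem_left, Real.norm_eq_abs, sq_abs]
    simp [PiLp.inner_apply, f, mul_comm]
  have h1 := lintegral_exp_projection_gaussianPi hb hv f hf
  have h2 : √2 ^ k ≤ Real.exp K := by
    have : √2 ≤ Real.exp 1 := by
      have h3 : √2 ≤ 2 := by rw [Real.sqrt_le_left (by norm_num)]; norm_num
      have := Real.add_one_le_exp (1 : ℝ)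
      linarith
    calc √2 ^ k ≤ Real.exp 1 ^ k := by gcongr
      _ = Real.exp k := by rw [← Real.exp_nat_mul, mul_one]
      _ ≤ _ := Real.exp_le_exp.2 hK
  have h3 := measure_le_of_lintegral_exp_le (μ := gaussianPi v)
    (f := fun x => ∑ j, (∑ i, f j i * x i) ^ 2 / (4 * b)) (t := K + q) (q := q) (by fun_prop)
    (h1.trans (ENNReal.ofReal_le_ofReal h2)) (by linarith)
  refine (measure_mono fun x hx => ?_).trans h3
  simp only [Set.mem_ofPred_eq] at hx ⊢
  rw [← Finset.sum_div, ← hnorm, lt_div_iff₀ (by positivity)]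
  linarith

theorem gaussianPi_hyperplane_eq_zero (hv : ∀ i, v i ≠ 0) {c : ι → ℝ} (hc : c ≠ 0) (t : ℝ) :
    gaussianPi v {x | ∑ i, c i * x i = t} = 0 := by
  obtain ⟨i, hi⟩ := Function.ne_iff.1 hc
  have hi : c i ≠ 0 := hi
  have hind : iIndepFun (fun i (x : ι → ℝ) => c i * x i) (gaussianPi v) :=
    iIndepFun_pi (X := fun i x => c i * x) fun i => by fun_prop
  have hlaw : ∀ i, HasGaussianLaw (fun x : ι → ℝ => c i * x i) (gaussianPi v) := fun i => by
    have h1 : HasGaussianLaw (fun x : ι → ℝ => x i) (gaussianPi v) := ⟨by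
      rw [show (gaussianPi v).map (fun x : ι → ℝ => x i) = gaussianReal 0 (v i) from
        (measurePreserving_eval (fun i => gaussianReal 0 (v i)) i).map_eq]
      infer_instance⟩
    exact h1.fun_smul (c i)
  have hsum := (iIndepFun.hasGaussianLaw_fun_sum hlaw hind).map_eq_gaussianReal
  have hvar : Var[fun x : ι → ℝ => ∑ i, c i * x i; gaussianPi v] ≠ 0 := by
    have h1 := IndepFun.variance_sum (X := fun i (x : ι → ℝ) => c i * x i) (s := Finset.univ)
      (μ := gaussianPi v) (fun i _ => (hlaw i).memLp_two)
      (fun i _ j _ hij => hind.indepFun hij)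
    have h2 : ∀ i, Var[fun x : ι → ℝ => c i * x i; gaussianPi v] = c i ^ 2 * v i := fun i => by
      rw [variance_const_mul]
      have h3 := (measurePreserving_eval (fun i => gaussianReal 0 (v i)) i).variance_fun_comp
        (f := fun y => y) aemeasurable_id
      simp only [variance_fun_id_gaussianReal] at h3
      rw [← h3]; rfl
    have h4 : (∑ i, fun x : ι → ℝ => c i * x i) = fun x => ∑ i, c i * x i := by ext x; simp
    rw [h4] at h1
    rw [h1]
    simp_rw [h2]
    refine (Finset.sum_pos' (fun i _ => by positivity) ⟨i, Finset.mem_univ _, ?_⟩).ne'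
    have := hv i
    positivity
  have hset : {x : ι → ℝ | ∑ i, c i * x i = t} = (fun x => ∑ i, c i * x i) ⁻¹' {t} := rfl
  rw [hset, ← Measure.map_apply (by fun_prop) (measurableSet_singleton t), hsum]
  have : NullSingletonClass (gaussianReal (gaussianPi v)[fun x : ι → ℝ => ∑ i, c i * x i]
      Var[fun x : ι → ℝ => ∑ i, c i * x i; gaussianPi v].toNNReal) :=
    nullSingletonClass_gaussianReal (by
      rw [Ne, Real.toNNReal_eq_zero, not_le]
      exact lt_of_le_of_ne (variance_nonneg _ _) hvar.symm)
  exact measure_singleton t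

end GaussianTails

/-! ### Independence of regression residuals, and conditional independence versus the inverse
covariance. -/

section GaussianSamples

open scoped ENNReal NNReal Matrix

/-- Under almost every conditional law the pair has a product distribution, so Fubini factorizes the
integral of the product. -/
theorem condExp_mul_of_condIndepFun {Ω : Type*} {m' : MeasurableSpace Ω} {mΩ : MeasurableSpace Ω}
    [StandardBorelSpace Ω] {hm' : m' ≤ mΩ} {μ : Measure Ω} [IsFiniteMeasure μ] {f g : Ω → ℝ}
    (hf : Measurable f) (hg : Measurable g) (h : CondIndepFun m' hm' f g μ)
    (hfi : Integrable f μ) (hgi : Integrable g μ) (hfg : Integrable (fun ω => f ω * g ω) μ) :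
    μ[fun ω => f ω * g ω | m'] =ᵐ[μ] μ[f | m'] * μ[g | m'] := by
  have h1 := ae_of_ae_trim hm' ((condIndepFun_iff_map_prod_eq_prod_map_map hf hg).1 h)
  filter_upwards [h1, condExp_ae_eq_integral_condExpKernel hm' hfi,
    condExp_ae_eq_integral_condExpKernel hm' hgi,
    condExp_ae_eq_integral_condExpKernel hm' hfg] with ω h1 h2 h3 h4
  rw [Pi.mul_apply, h2, h3, h4]
  have hf' : @Measurable Ω ℝ mΩ _ f := hf
  have hg' : @Measurable Ω ℝ mΩ _ g := hg
  rw [Kernel.map_apply _ (hf'.prodMk hg'), Kernel.prod_apply, Kernel.map_apply _ hf',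
    Kernel.map_apply _ hg'] at h1
  have h5 := integral_map (μ := condExpKernel μ m' ω) (φ := fun ω => (f ω, g ω))
    (hf'.prodMk hg').aemeasurable (f := fun y : ℝ × ℝ => y.1 * y.2) (by fun_prop)
  rw [← h5, h1, integral_prod_mul (f := fun y : ℝ => y) (g := fun y : ℝ => y),
    integral_map hf'.aemeasurable (by fun_prop), integral_map hg'.aemeasurable (by fun_prop)]

variable {N d : ℕ}

/-- `P` is the law of a centered Gaussian process that is uncorrelated over time and has
covariance matrices `C n`. -/
structure IsUncorrelatedGaussian (P : Measure (Fin N → Fin d → ℝ))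
    (C : Fin N → Matrix (Fin d) (Fin d) ℝ) : Prop where
  gaussian : IsGaussian P
  mean : ∀ n i, ∫ x, x n i ∂P = 0
  cov : ∀ n n' i j, ∫ x, x n i * x n' j ∂P = if n = n' then C n i j else 0

/-- The process `p[n] · x[n]`. -/
def linearSeries (p : Fin N → Fin d → ℝ) (x : Fin N → Fin d → ℝ) (n : Fin N) : ℝ :=
  p n ⬝ᵥ x n

@[fun_prop]
theorem measurable_linearSeries (p : Fin N → Fin d → ℝ) : Measurable (linearSeries p) := by
  unfold linearSeries dotProduct
  fun_prop

/-- The continuous linear form `x ↦ p · x[n]`. -/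
noncomputable def dotCLM (p : Fin d → ℝ) (n : Fin N) : (Fin N → Fin d → ℝ) →L[ℝ] ℝ :=
  (∑ i, p i • (ContinuousLinearMap.proj i : (Fin d → ℝ) →L[ℝ] ℝ)).comp
    (ContinuousLinearMap.proj n : (Fin N → Fin d → ℝ) →L[ℝ] (Fin d → ℝ))

theorem dotCLM_apply (p : Fin d → ℝ) (n : Fin N) (x : Fin N → Fin d → ℝ) :
    dotCLM p n x = p ⬝ᵥ x n := by
  simp [dotCLM, dotProduct]

/-- The process whose components outside `S` are set to zero. -/
def maskComponents (S : Finset (Fin d)) (x : Fin N → Fin d → ℝ) (n : Fin N) (i : Fin d) : ℝ :=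
  if i ∈ S then x n i else 0

@[fun_prop]
theorem measurable_maskComponents (S : Finset (Fin d)) :
    Measurable (maskComponents (N := N) S) := by
  unfold maskComponents
  refine measurable_pi_lambda _ fun n => measurable_pi_lambda _ fun i => ?_
  split_ifs <;> fun_prop

/-- The σ-algebra generated by the components in `T`. -/
@[reducible] def componentsSigma (N : ℕ) (T : Finset (Fin d)) : MeasurableSpace (Fin N → Fin d → ℝ) :=
  MeasurableSpace.comap
    (fun (x : Fin N → Fin d → ℝ) (c : (T : Set (Fin d))) (n : Fin N) => x n c) inferInstance

theorem measurable_restrictComponents (N : ℕ) (T : Finset (Fin d)) :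
    Measurable (fun (x : Fin N → Fin d → ℝ) (c : (T : Set (Fin d))) (n : Fin N) => x n c) := by
  fun_prop

theorem componentsSigma_le (N : ℕ) (T : Finset (Fin d)) :
    componentsSigma N T ≤ (inferInstance : MeasurableSpace (Fin N → Fin d → ℝ)) :=
  (measurable_restrictComponents N T).comap_le

theorem measurable_mask_componentsSigma (N : ℕ) (T : Finset (Fin d)) :
    Measurable[componentsSigma N T] (maskComponents (N := N) T) := by
  have h : maskComponents (N := N) T =
      (fun (y : ↥(T : Set (Fin d)) → Fin N → ℝ) n i => if hi : i ∈ T then y ⟨i, hi⟩ n else 0) ∘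
        (fun (x : Fin N → Fin d → ℝ) (c : (T : Set (Fin d))) (n : Fin N) => x n c) := by
    ext x n i
    simp [maskComponents]
  rw [h]
  refine Measurable.comp ?_ (comap_measurable _)
  refine measurable_pi_lambda _ fun n => measurable_pi_lambda _ fun i => ?_
  split_ifs <;> fun_prop

theorem componentsSigma_le_comap_mask (N : ℕ) (T : Finset (Fin d)) :
    componentsSigma N T ≤ MeasurableSpace.comap (maskComponents (N := N) T) inferInstance := by
  rintro _ ⟨s, hs, rfl⟩
  refine ⟨_, measurable_restrictComponents N T hs, ?_⟩
  ext x
  simp only [Set.mem_preimage]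
  have : (fun (c : (T : Set (Fin d))) (n : Fin N) => maskComponents T x n c) =
      fun (c : (T : Set (Fin d))) (n : Fin N) => x n c := by
    ext c n
    have : (c : Fin d) ∈ T := c.2
    simp [maskComponents, this]
  rw [this]

namespace IsUncorrelatedGaussian

variable {P : Measure (Fin N → Fin d → ℝ)} {C : Fin N → Matrix (Fin d) (Fin d) ℝ}

theorem isProbabilityMeasure (h : IsUncorrelatedGaussian P C) : IsProbabilityMeasure P :=
  have := h.gaussian
  inferInstance

theorem hasGaussianLaw (h : IsUncorrelatedGaussian P C) :
    HasGaussianLaw (fun x : Fin N → Fin d → ℝ => x) P :=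
  have := h.gaussian
  IsGaussian.hasGaussianLaw_id

theorem hasGaussianLaw_coord (h : IsUncorrelatedGaussian P C) (n : Fin N) (i : Fin d) :
    HasGaussianLaw (fun x : Fin N → Fin d → ℝ => x n i) P :=
  (h.hasGaussianLaw.map_fun (dotCLM (Pi.single i 1) n)).congr
    (ae_of_all _ fun x => by simp [dotCLM_apply])

theorem memLp_coord (h : IsUncorrelatedGaussian P C) (n : Fin N) (i : Fin d) :
    MemLp (fun x : Fin N → Fin d → ℝ => x n i) 2 P :=
  (h.hasGaussianLaw_coord n i).memLp_two

theorem memLp_linear (h : IsUncorrelatedGaussian P C) (p : Fin d → ℝ) (n : Fin N) :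
    MemLp (fun x : Fin N → Fin d → ℝ => p ⬝ᵥ x n) 2 P := by
  unfold dotProduct
  exact memLp_finsetSum _ fun i _ => (h.memLp_coord n i).const_mul _

theorem integral_linear (h : IsUncorrelatedGaussian P C) (p : Fin d → ℝ) (n : Fin N) :
    ∫ x, p ⬝ᵥ x n ∂P = 0 := by
  have := h.isProbabilityMeasure
  unfold dotProduct
  rw [integral_finsetSum _ fun i _ =>
    ((h.memLp_coord n i).integrable one_le_two).const_mul _]
  simp [integral_const_mul, h.mean]

theorem integral_linear_mul (h : IsUncorrelatedGaussian P C) (p q : Fin d → ℝ) (n n' : Fin N) :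
    ∫ x, (p ⬝ᵥ x n) * (q ⬝ᵥ x n') ∂P = if n = n' then p ⬝ᵥ C n *ᵥ q else 0 := by
  have hint : ∀ i j, Integrable (fun x : Fin N → Fin d → ℝ => (p i * x n i) * (q j * x n' j)) P :=
    fun i j => ((h.memLp_coord n i).const_mul _).integrable_mul ((h.memLp_coord n' j).const_mul _)
  simp only [dotProduct, Finset.sum_mul_sum]
  rw [integral_finsetSum _ fun i _ => integrable_finsetSum _ fun j _ => hint i j]
  simp_rw [integral_finsetSum _ fun j _ => hint _ j]
  have h1 : ∀ i j, ∫ x, (p i * x n i) * (q j * x n' j) ∂P =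
      p i * (if n = n' then C n i j else 0) * q j := by
    intro i j
    rw [← h.cov, ← integral_const_mul, ← integral_mul_const]
    congr 1; ext x; ring
  simp_rw [h1]
  split_ifs
  · simp only [Matrix.mulVec, dotProduct, Finset.mul_sum, mul_assoc]
  · simp

theorem cov_linear (h : IsUncorrelatedGaussian P C) (p q : Fin d → ℝ) (n n' : Fin N) :
    cov[fun x : Fin N → Fin d → ℝ => p ⬝ᵥ x n, fun x => q ⬝ᵥ x n'; P] =
      if n = n' then p ⬝ᵥ C n *ᵥ q else 0 := by
  have := h.isProbabilityMeasure
  rw [covariance_eq_sub (h.memLp_linear p n) (h.memLp_linear q n'), h.integral_linear,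
    zero_mul, sub_zero, ← h.integral_linear_mul]
  rfl

theorem hasGaussianLaw_linearSeries (h : IsUncorrelatedGaussian P C) (p : Fin N → Fin d → ℝ) :
    HasGaussianLaw (linearSeries p) P :=
  (h.hasGaussianLaw.map_fun (ContinuousLinearMap.pi fun n => dotCLM (p n) n)).congr
    (ae_of_all _ fun x => by
      ext n
      simp [linearSeries, dotCLM_apply])

theorem map_linearSeries (h : IsUncorrelatedGaussian P C) (p : Fin N → Fin d → ℝ) :
    P.map (linearSeries p) = gaussianPi fun n => (p n ⬝ᵥ C n *ᵥ p n).toNNReal := by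
  have := h.isProbabilityMeasure
  have h1 : HasGaussianLaw (fun x => (fun n => linearSeries p x n)) P :=
    h.hasGaussianLaw_linearSeries p
  have h2 : iIndepFun (fun n x => linearSeries p x n) P :=
    HasGaussianLaw.iIndepFun_of_covariance_eq_zero (X := fun n x => linearSeries p x n) h1
      fun n n' hn => by
        have := h.cov_linear (p n) (p n') n n'
        rw [if_neg hn] at this
        exact this
  have h3 := (iIndepFun_iff_map_fun_eq_pi_map fun n => by fun_prop).1 h2
  rw [gaussianPi]
  refine h3.trans ?_
  congr 1
  ext1 n
  rw [(h1.eval n).map_eq_gaussianReal]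
  congr 1
  · exact h.integral_linear (p n) n
  · congr 1
    rw [← covariance_self (by fun_prop)]
    have := h.cov_linear (p n) (p n) n n
    rw [if_pos rfl] at this
    exact this

/-- The hypothesis says that p[n]·x[n] is uncorrelated with every component in S at time n; at
different times everything is uncorrelated. Joint Gaussianity turns this into independence of the
whole series. -/
theorem indepFun_mask_linearSeries (h : IsUncorrelatedGaussian P C) (S : Finset (Fin d))
    (p : Fin N → Fin d → ℝ) (hp : ∀ n, ∀ j ∈ S, (C n *ᵥ p n) j = 0) :
    IndepFun (maskComponents S) (linearSeries p) P := by
  have := h.isProbabilityMeasure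
  let e : Fin N × Fin d → Fin d → ℝ := fun k => if k.2 ∈ S then Pi.single k.2 1 else 0
  have he : ∀ (k : Fin N × Fin d) (x : Fin N → Fin d → ℝ),
      e k ⬝ᵥ x k.1 = maskComponents S x k.1 k.2 := by
    intro k x
    by_cases hk : k.2 ∈ S <;> simp [e, hk, maskComponents]
  have hg : HasGaussianLaw (fun x : Fin N → Fin d → ℝ =>
      ((fun k : Fin N × Fin d => e k ⬝ᵥ x k.1), fun n => linearSeries p x n)) P :=
    (h.hasGaussianLaw.map_fun ((ContinuousLinearMap.pi fun k : Fin N × Fin d =>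
      dotCLM (e k) k.1).prod (ContinuousLinearMap.pi fun n => dotCLM (p n) n))).congr
    (ae_of_all _ fun x => by
      refine Prod.ext (funext fun k => ?_) (funext fun n => ?_)
      · simp [dotCLM_apply]
      · simp [linearSeries, dotCLM_apply])
  have hind := hg.indepFun_of_covariance_eval (X := fun (k : Fin N × Fin d) x => e k ⬝ᵥ x k.1)
    (Y := fun n x => linearSeries p x n) (fun k n => by
      have h1 := h.cov_linear (e k) (p n) k.1 n
      refine h1.trans ?_
      split_ifs with hk
      · rw [hk]
        by_cases hS : k.2 ∈ S
        · simp [e, hS, hp n k.2 hS]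
        · simp [e, hS]
      · rfl)
  have h2 := hind.comp (φ := fun (y : Fin N × Fin d → ℝ) (n : Fin N) (i : Fin d) => y (n, i))
    (ψ := id) (by fun_prop) measurable_id
  convert! h2 using 1
  ext x n i
  simp [he (n, i)]

/-- Bounds for the probability of an event that hold conditionally on the components in `S`. -/
theorem measure_le_of_conditional (h : IsUncorrelatedGaussian P C) (S : Finset (Fin d))
    {p : Fin N → Fin d → ℝ} (hp : ∀ n, ∀ j ∈ S, (C n *ᵥ p n) j = 0)
    {A : Set ((Fin N → Fin d → ℝ) × (Fin N → ℝ))} (hA : MeasurableSet A)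
    (hinv : ∀ x y, (x, y) ∈ A ↔ (maskComponents S x, y) ∈ A) {c : ℝ≥0∞}
    (hc : ∀ z, gaussianPi (fun n => (p n ⬝ᵥ C n *ᵥ p n).toNNReal) {y | (z, y) ∈ A} ≤ c) :
    P {x | (x, linearSeries p x) ∈ A} ≤ c := by
  have := h.isProbabilityMeasure
  have hind := h.indepFun_mask_linearSeries S p hp
  have h1 := (indepFun_iff_map_prod_eq_prod_map_map (by fun_prop) (by fun_prop)).1 hind
  rw [h.map_linearSeries] at h1
  have h2 : P {x | (x, linearSeries p x) ∈ A} =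
      P.map (fun x => (maskComponents S x, linearSeries p x)) A := by
    rw [Measure.map_apply (by fun_prop) hA]
    congr 1
    ext x
    exact hinv x _
  have : IsProbabilityMeasure (P.map (maskComponents S)) :=
    Measure.isProbabilityMeasure_map (by fun_prop)
  rw [h2, h1, Measure.prod_apply hA]
  calc _ ≤ ∫⁻ _, c ∂(P.map (maskComponents S)) := lintegral_mono fun z => hc z
    _ = c := by simp

theorem cov_isSymm (h : IsUncorrelatedGaussian P C) (n : Fin N) : (C n).IsSymm := by
  ext i j
  have h1 := h.cov n n i j
  have h2 := h.cov n n j i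
  simp only [if_true] at h1 h2
  rw [Matrix.transpose_apply, ← h1, ← h2]
  simp_rw [mul_comm]

/-- The conditional expectation of a component given others is the linear regression. -/
theorem condExp_coord (h : IsUncorrelatedGaussian P C) (T : Finset (Fin d)) (n : Fin N)
    {c : Fin d} {g : Fin d → ℝ} (hg : ∀ i ∉ T, g i = 0)
    (hgT : ∀ j ∈ T, (C n *ᵥ (Pi.single c 1 - g)) j = 0) :
    P[fun x : Fin N → Fin d → ℝ => x n c | componentsSigma N T] =ᵐ[P] fun x => g ⬝ᵥ x n := by
  have := h.isProbabilityMeasure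
  set r := Pi.single c 1 - g with hr
  have hle := componentsSigma_le N T
  have hind := h.indepFun_mask_linearSeries T (fun k => if k = n then r else 0)
    (fun k j hj => by
      split_ifs with hk
      · rw [hk]; exact hgT j hj
      · simp)
  have hlin : ∀ r : Fin d → ℝ, Measurable (fun x : Fin d → ℝ => r ⬝ᵥ x) := fun r => by
    unfold dotProduct; fun_prop
  have hrm : Measurable (fun x : Fin N → Fin d → ℝ => r ⬝ᵥ x n) :=
    (hlin r).comp (measurable_pi_apply n)
  have hind2 : IndepFun (fun x : Fin N → Fin d → ℝ => r ⬝ᵥ x n) (maskComponents (N := N) T) P := by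
    have hev : Measurable fun y : Fin N → ℝ => y n := measurable_pi_apply n
    have := (hind.comp measurable_id hev).symm
    convert! this using 1
    ext x
    simp [linearSeries]
  have hind3 : Indep (MeasurableSpace.comap (fun x : Fin N → Fin d → ℝ => r ⬝ᵥ x n)
      inferInstance) (componentsSigma N T) P :=
    indep_of_indep_of_le_right hind2 (componentsSigma_le_comap_mask N T)
  have hce := condExp_indep_eq hrm.comap_le hle
    (comap_measurable (fun x : Fin N → Fin d → ℝ => r ⬝ᵥ x n)).stronglyMeasurable hind3
  have hgm : Measurable[componentsSigma N T] fun x : Fin N → Fin d → ℝ => g ⬝ᵥ x n := by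
    have : (fun x : Fin N → Fin d → ℝ => g ⬝ᵥ x n) =
        (fun y : Fin N → Fin d → ℝ => g ⬝ᵥ y n) ∘ maskComponents T := by
      ext x
      simp only [Function.comp_apply, dotProduct]
      refine Finset.sum_congr rfl fun i _ => ?_
      by_cases hi : i ∈ T
      · simp [maskComponents, hi]
      · simp [hg i hi]
    rw [this]
    exact Measurable.comp ((hlin g).comp (measurable_pi_apply n)) (measurable_mask_componentsSigma N T)
  have hgi : Integrable (fun x : Fin N → Fin d → ℝ => g ⬝ᵥ x n) P :=
    (h.memLp_linear g n).integrable one_le_two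
  have hri : Integrable (fun x : Fin N → Fin d → ℝ => r ⬝ᵥ x n) P :=
    (h.memLp_linear r n).integrable one_le_two
  have hsum : (fun x : Fin N → Fin d → ℝ => x n c) =
      (fun x => r ⬝ᵥ x n) + fun x => g ⬝ᵥ x n := by
    ext x
    rw [Pi.add_apply, ← add_dotProduct, hr, sub_add_cancel]
    simp
  rw [hsum]
  refine (condExp_add hri hgi _).trans ?_
  filter_upwards [hce] with x hx
  rw [Pi.add_apply, hx, h.integral_linear,
    condExp_of_stronglyMeasurable hle hgm.stronglyMeasurable hgi]
  simp

/-- Conditional independence of two components of a Gaussian process, given all the others,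
forces the corresponding entries of the inverse covariance matrices to vanish. -/
theorem inv_apply_eq_zero_of_condIndep [IsFiniteMeasure P] (h : IsUncorrelatedGaussian P C)
    {a b : Fin d} (hab : a ≠ b) (hci : ComponentsCondIndep P ({a, b}ᶜ) a b) (n : Fin N)
    {l u : ℝ} (hl : 0 < l) (hC : QuadBounded (C n) l u) : (C n)⁻¹ a b = 0 := by
  set T : Finset (Fin d) := {a, b}ᶜ with hT
  have hTS : ({a, b}ᶜ : Set (Fin d)) = (T : Set (Fin d)) := by
    rw [hT, Finset.coe_compl, Finset.coe_pair]
  rw [hTS] at hci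
  obtain ⟨ga, hga, hgaT⟩ := hC.exists_regression hl T (Pi.single a 1)
  obtain ⟨gb, hgb, hgbT⟩ := hC.exists_regression hl T (Pi.single b 1)
  have key_a := h.condExp_coord T n hga hgaT
  have key_b := h.condExp_coord T n hgb hgbT
  set p := Pi.single a 1 - ga
  set q := Pi.single b 1 - gb
  have haT : a ∉ T := by simp [hT]
  have hbT : b ∉ T := by simp [hT]
  have hci' : CondIndepFun (componentsSigma N T) (componentsSigma_le N T)
      (fun x : Fin N → Fin d → ℝ => x n a) (fun x => x n b) P :=
    CondIndepFun.comp (φ := fun y : Fin N → ℝ => y n) (ψ := fun y : Fin N → ℝ => y n)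
      hci (measurable_pi_apply n) (measurable_pi_apply n)
  have hprod := condExp_mul_of_condIndepFun (by fun_prop) (by fun_prop) hci'
    ((h.memLp_coord n a).integrable one_le_two) ((h.memLp_coord n b).integrable one_le_two)
    ((h.memLp_coord n a).integrable_mul (h.memLp_coord n b))
  -- The conditional expectation of the product x_a x_b is the product of the two linear
  -- regressions; taking expectations gives the identity. Hence the partial covariance of a and b,
  -- which is the form at p and q, vanishes.
  have hCab : C n a b = ga ⬝ᵥ C n *ᵥ gb := by
    have h1 := h.cov n n a b
    have h2 := h.integral_linear_mul ga gb n n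
    simp only [if_true] at h1 h2
    rw [← h1, ← h2, ← integral_condExp (componentsSigma_le N T)]
    refine integral_congr_ae ?_
    filter_upwards [hprod, key_a, key_b] with x h1 h2 h3
    rw [h1, Pi.mul_apply, h2, h3]
  have hzero : ∀ g r : Fin d → ℝ, (∀ i ∉ T, g i = 0) → (∀ j ∈ T, (C n *ᵥ r) j = 0) →
      g ⬝ᵥ C n *ᵥ r = 0 := by
    intro g r hg hr
    refine Finset.sum_eq_zero fun j _ => ?_
    by_cases hj : j ∈ T
    · rw [hr j hj, mul_zero]
    · rw [hg j hj, zero_mul]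
  have h0 : p ⬝ᵥ C n *ᵥ q = 0 := by
    have h1 : (Pi.single a 1 : Fin d → ℝ) ⬝ᵥ C n *ᵥ Pi.single b 1 = C n a b := by simp
    have h2 : gb ⬝ᵥ C n *ᵥ p = 0 := hzero _ _ hgb hgaT
    have h3 : ga ⬝ᵥ C n *ᵥ q = 0 := hzero _ _ hga hgbT
    have h4 : Pi.single a 1 = p + ga := by simp [p]
    have h5 : Pi.single b 1 = q + gb := by simp [q]
    rw [h4, h5, hCab, Matrix.mulVec_add, add_dotProduct, dotProduct_add, dotProduct_add, h3,
      hC.symm.dotProduct_mulVec_comm p gb, h2] at h1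
    linarith
  have hqa : (C n *ᵥ q) a = 0 := by
    have h1 : p ⬝ᵥ C n *ᵥ q = (C n *ᵥ q) a := by
      rw [dotProduct, Finset.sum_eq_single a]
      · simp [p, hga a haT]
      · intro j _ hj
        by_cases hjT : j ∈ T
        · rw [hgbT j hjT, mul_zero]
        · have : j = b := by
            simp [hT] at hjT; tauto
          rw [this]
          simp [p, hga b hbT, hab.symm]
      · simp
    rw [← h1, h0]
  -- So q is a multiple of column b of the inverse. Its entry at b is 1 and its entry at a is 0,
  -- which forces the entry of the inverse to vanish.
  have hCq : C n *ᵥ q = Pi.single b ((C n *ᵥ q) b) := by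
    ext j
    by_cases hjb : j = b
    · rw [hjb]; simp
    · rw [Pi.single_eq_of_ne hjb]
      by_cases hja : j = a
      · rw [hja, hqa]
      · exact hgbT j (by simp [hT, hja, hjb])
  have hq : q = (C n)⁻¹ *ᵥ Pi.single b ((C n *ᵥ q) b) := by
    rw [← hCq, Matrix.mulVec_mulVec, Matrix.nonsing_inv_mul _ (hC.isUnit_det hl),
      Matrix.one_mulVec]
  have hqa' := congrFun hq a
  have hqb' := congrFun hq b
  simp [q, hgb b hbT, hgb a haT, hab] at hqa' hqb'
  rcases hqa' with h1 | h1
  · exact h1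
  · rw [h1] at hqb'; simp at hqb'

end IsUncorrelatedGaussian

end GaussianSamples

/-! ### Distance to the blockwise span of data, and the tail bounds conditional on that span. -/

section BlockSpan

open scoped ENNReal NNReal Matrix

/-- The component of `y` orthogonal to `U`. -/
noncomputable def orthResidual {ι : Type*} [Fintype ι] (U : Submodule ℝ (EuclideanSpace ℝ ι))
    (y : EuclideanSpace ℝ ι) : EuclideanSpace ℝ ι :=
  y - U.starProjection y

section Residual

variable {ι : Type*} [Fintype ι] (U : Submodule ℝ (EuclideanSpace ℝ ι))

theorem orthResidual_mem_orthogonal (y : EuclideanSpace ℝ ι) : orthResidual U y ∈ Uᗮ :=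
  U.sub_starProjection_mem_orthogonal y

theorem orthResidual_add (y z : EuclideanSpace ℝ ι) :
    orthResidual U (y + z) = orthResidual U y + orthResidual U z := by
  simp only [orthResidual, map_add]; abel

theorem orthResidual_eq_zero_iff {y : EuclideanSpace ℝ ι} : orthResidual U y = 0 ↔ y ∈ U := by
  rw [orthResidual, sub_eq_zero, eq_comm, U.starProjection_eq_self_iff]

theorem norm_orthResidual_le (y : EuclideanSpace ℝ ι) {w : EuclideanSpace ℝ ι} (hw : w ∈ U) :
    ‖orthResidual U y‖ ≤ ‖y - w‖ := by
  rw [orthResidual, U.starProjection_minimal]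
  exact ciInf_le ⟨0, by rintro _ ⟨x, rfl⟩; exact norm_nonneg _⟩ (⟨w, hw⟩ : U)

theorem inner_orthResidual (y z : EuclideanSpace ℝ ι) :
    inner ℝ y (orthResidual U z) = inner ℝ (orthResidual U y) (orthResidual U z) := by
  have h : inner ℝ (U.starProjection y) (orthResidual U z) = 0 :=
    (orthResidual_mem_orthogonal U z) _ (U.starProjection_apply_mem y)
  nth_rw 2 [orthResidual]
  rw [inner_sub_left, h, sub_zero]

theorem norm_sq_eq_orthResidual_add (y : EuclideanSpace ℝ ι) :
    ‖y‖ ^ 2 = ‖orthResidual U y‖ ^ 2 + ‖U.starProjection y‖ ^ 2 := by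
  have h : inner ℝ (U.starProjection y) (orthResidual U y) = 0 :=
    (orthResidual_mem_orthogonal U y) _ (U.starProjection_apply_mem y)
  have h2 : y = U.starProjection y + orthResidual U y := by rw [orthResidual]; abel
  nth_rw 1 [h2]
  rw [norm_add_sq_real, h]; ring

/-- This polarization also yields measurability of the inner product, which is a combination of
distances to the random subspace. -/
theorem inner_orthResidual_eq (y z : EuclideanSpace ℝ ι) :
    inner ℝ (orthResidual U z) y =
      (‖orthResidual U (y + z)‖ ^ 2 - ‖orthResidual U y‖ ^ 2 - ‖orthResidual U z‖ ^ 2) / 2 := by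
  rw [real_inner_comm, inner_orthResidual, orthResidual_add, norm_add_sq_real]; ring

theorem norm_orthResidual_add_sq (y z : EuclideanSpace ℝ ι) :
    ‖orthResidual U (y + z)‖ ^ 2 = ‖y‖ ^ 2 - ‖U.starProjection y‖ ^ 2 +
      2 * inner ℝ (orthResidual U z) y + ‖orthResidual U z‖ ^ 2 := by
  rw [inner_orthResidual_eq, norm_sq_eq_orthResidual_add U y]; ring

/-- The distance to the span of measurable vectors is measurable. -/
theorem measurable_norm_orthResidual {α κ : Type*} [MeasurableSpace α] [Finite κ]
    {φ : κ → α → EuclideanSpace ℝ ι} (hφ : ∀ k, Measurable (φ k)) {y : α → EuclideanSpace ℝ ι}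
    (hy : Measurable y) :
    Measurable fun a => ‖orthResidual (Submodule.span ℝ (Set.range fun k => φ k a)) (y a)‖ := by
  have := Fintype.ofFinite κ
  refine measurable_of_Iio fun t => ?_
  -- The distance is an infimum over coefficient vectors, and by continuity rational ones suffice,
  -- so the sublevel set is a countable union.
  have hset : (fun a => ‖orthResidual (Submodule.span ℝ (Set.range fun k => φ k a)) (y a)‖) ⁻¹'
      Set.Iio t = ⋃ c : κ → ℚ, {a | ‖y a - ∑ k, (c k : ℝ) • φ k a‖ < t} := by
    ext a
    simp only [Set.mem_preimage, Set.mem_Iio, Set.mem_iUnion, Set.mem_ofPred_eq]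
    constructor
    · intro h
      obtain ⟨c, hc⟩ := Submodule.mem_span_range_iff_exists_fun ℝ |>.1
        (Submodule.starProjection_apply_mem (Submodule.span ℝ (Set.range fun k => φ k a)) (y a))
      have hopen : IsOpen {c : κ → ℝ | ‖y a - ∑ k, c k • φ k a‖ < t} :=
        isOpen_lt (by fun_prop) continuous_const
      have hd : DenseRange (Pi.map fun (_ : κ) (r : ℚ) => (r : ℝ)) :=
        DenseRange.piMap fun _ => Rat.denseRange_cast
      obtain ⟨r, hr⟩ := hd.exists_mem_open hopen ⟨c, by
        simp only [Set.mem_ofPred_eq]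
        rw [hc]; exact h⟩
      exact ⟨r, hr⟩
    · rintro ⟨c, hc⟩
      refine (norm_orthResidual_le _ _ ?_).trans_lt hc
      exact Submodule.sum_mem _ fun k _ => Submodule.smul_mem _ _
        (Submodule.subset_span ⟨k, rfl⟩)
  rw [hset]
  exact MeasurableSet.iUnion fun c => measurableSet_lt (by fun_prop) measurable_const

end Residual

variable {N d : ℕ}

/-- The data of component `i` in the `b`-th block of length `L`, extended by zero. -/
noncomputable def blockColumn (L : ℕ) (x : Fin N → Fin d → ℝ) (b : ℕ) (i : Fin d) :
    EuclideanSpace ℝ (Fin N) :=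
  WithLp.toLp 2 fun n => if n.val / L = b then x n i else 0

/-- The span of the data of the components in `T`, with separate coefficients in each block. -/
noncomputable def blockSpan (L : ℕ) (T : Finset (Fin d)) (x : Fin N → Fin d → ℝ) :
    Submodule ℝ (EuclideanSpace ℝ (Fin N)) :=
  Submodule.span ℝ (Set.range fun k : Fin (N / L) × T => blockColumn L x k.1 k.2)

theorem finrank_blockSpan_le (L : ℕ) (T : Finset (Fin d)) (x : Fin N → Fin d → ℝ) :
    Module.finrank ℝ (blockSpan L T x) ≤ N / L * T.card := by
  refine (finrank_range_le_card _).trans ?_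
  simp

theorem blockColumn_mask (L : ℕ) {S : Finset (Fin d)} (x : Fin N → Fin d → ℝ) (b : ℕ) {i : Fin d}
    (hi : i ∈ S) : blockColumn L (maskComponents S x) b i = blockColumn L x b i := by
  simp [blockColumn, maskComponents, hi]

theorem blockSpan_mask (L : ℕ) {S T : Finset (Fin d)} (hTS : T ⊆ S) (x : Fin N → Fin d → ℝ) :
    blockSpan L T (maskComponents S x) = blockSpan L T x := by
  have : (fun k : Fin (N / L) × T => blockColumn L (maskComponents S x) k.1 k.2) =
      fun k : Fin (N / L) × T => blockColumn L x k.1 k.2 :=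
    funext fun k => blockColumn_mask L x _ (hTS k.2.2)
  rw [blockSpan, this, blockSpan]

@[fun_prop]
theorem measurable_blockColumn (L b : ℕ) (i : Fin d) :
    Measurable fun x : Fin N → Fin d → ℝ => blockColumn L x b i := by
  unfold blockColumn
  refine (WithLp.measurable_toLp 2 _).comp (measurable_pi_lambda _ fun n => ?_)
  split_ifs <;> fun_prop

theorem measurable_norm_orthResidual_blockSpan {α : Type*} [MeasurableSpace α] (L : ℕ)
    (T : Finset (Fin d)) {f : α → Fin N → Fin d → ℝ} (hf : Measurable f)
    {y : α → EuclideanSpace ℝ (Fin N)} (hy : Measurable y) :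
    Measurable fun a => ‖orthResidual (blockSpan L T (f a)) (y a)‖ :=
  measurable_norm_orthResidual (φ := fun (k : Fin (N / L) × T) a => blockColumn L (f a) k.1 k.2)
    (fun _ => (measurable_blockColumn L _ _).comp hf) hy

namespace IsUncorrelatedGaussian

variable {P : Measure (Fin N → Fin d → ℝ)} {C : Fin N → Matrix (Fin d) (Fin d) ℝ}
  {p : Fin N → Fin d → ℝ} {S T : Finset (Fin d)} {b q K : ℝ}

/-- The span depends only on components in S, which are independent of p·x. Once these are frozen it
is a fixed subspace of dimension at most K. -/
theorem projection_tail (h : IsUncorrelatedGaussian P C)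
    (hp : ∀ n, ∀ j ∈ S, (C n *ᵥ p n) j = 0) (hTS : T ⊆ S) (hb : 0 < b)
    (hpb : ∀ n, p n ⬝ᵥ C n *ᵥ p n ≤ b) (L : ℕ) (hK : ((N / L * T.card : ℕ) : ℝ) ≤ K) :
    P {x | 4 * b * (K + q) <
        ‖(blockSpan L T x).starProjection (WithLp.toLp 2 (linearSeries p x))‖ ^ 2} ≤
      ENNReal.ofReal (Real.exp (-q)) := by
  have hproj : ∀ (x : Fin N → Fin d → ℝ) (y : Fin N → ℝ),
      ‖(blockSpan L T x).starProjection (WithLp.toLp 2 y)‖ ^ 2 =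
        ‖WithLp.toLp 2 y‖ ^ 2 - ‖orthResidual (blockSpan L T x) (WithLp.toLp 2 y)‖ ^ 2 := by
    intro x y
    have := norm_sq_eq_orthResidual_add (blockSpan L T x) (WithLp.toLp 2 y)
    linarith
  refine h.measure_le_of_conditional S hp
    (A := {z | 4 * b * (K + q) < ‖(blockSpan L T z.1).starProjection (WithLp.toLp 2 z.2)‖ ^ 2})
    ?_ (fun x y => by simp only [Set.mem_ofPred_eq, blockSpan_mask L hTS]) fun z => ?_
  · simp_rw [hproj]
    have h2 : Measurable fun z : (Fin N → Fin d → ℝ) × (Fin N → ℝ) =>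
        (WithLp.toLp 2 z.2 : EuclideanSpace ℝ (Fin N)) :=
      (WithLp.measurable_toLp 2 _).comp measurable_snd
    have h1 := measurable_norm_orthResidual_blockSpan L T
      (measurable_fst (α := Fin N → Fin d → ℝ) (β := Fin N → ℝ)) h2
    exact measurableSet_lt measurable_const ((h2.norm.pow_const 2).sub (h1.pow_const 2))
  · exact gaussianPi_projection_tail (v := fun n => (p n ⬝ᵥ C n *ᵥ p n).toNNReal) (q := q) hb
      (fun n => by
        rw [Real.coe_toNNReal', max_le_iff]
        exact ⟨hpb n, hb.le⟩) (blockSpan L T z)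
      (le_trans (by exact_mod_cast finrank_blockSpan_le L T z) hK)

/-- The random direction c is a function of the components in S and can be frozen, leaving a fixed
linear form in Gaussian noise. -/
theorem linear_tail (h : IsUncorrelatedGaussian P C)
    (hp : ∀ n, ∀ j ∈ S, (C n *ᵥ p n) j = 0) (hb : 0 < b) (hq : 0 < q)
    (hpb : ∀ n, p n ⬝ᵥ C n *ᵥ p n ≤ b) {c : (Fin N → Fin d → ℝ) → EuclideanSpace ℝ (Fin N)}
    (hc : ∀ x, c (maskComponents S x) = c x) (hcn : Measurable fun x => ‖c x‖)
    (hci : Measurable fun z : (Fin N → Fin d → ℝ) × (Fin N → ℝ) =>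
      inner ℝ (c z.1) (WithLp.toLp 2 z.2)) :
    P {x | √(2 * b * q) * ‖c x‖ < inner ℝ (c x) (WithLp.toLp 2 (linearSeries p x))} ≤
      ENNReal.ofReal (Real.exp (-q)) := by
  refine h.measure_le_of_conditional S hp
    (A := {z | √(2 * b * q) * ‖c z.1‖ < inner ℝ (c z.1) (WithLp.toLp 2 z.2)})
    (measurableSet_lt ((hcn.comp measurable_fst).const_mul _) hci)
    (fun x y => by simp only [Set.mem_ofPred_eq, hc]) fun z => ?_
  have h1 := gaussianPi_linear_tail (v := fun n => (p n ⬝ᵥ C n *ᵥ p n).toNNReal) (q := q) hb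
    (fun n => by
      rw [Real.coe_toNNReal', max_le_iff]
      exact ⟨hpb n, hb.le⟩) hq (c z)
  refine (measure_mono fun y hy => ?_).trans h1
  simp only [Set.mem_ofPred_eq] at hy ⊢
  rw [EuclideanSpace.norm_eq] at hy
  simpa [PiLp.inner_apply, mul_comm] using hy

/-- Controls the cross term in `norm_orthResidual_add_sq`; the lower tail is the upper tail in the
opposite direction. -/
theorem linear_residual_tail (h : IsUncorrelatedGaussian P C)
    (hp : ∀ n, ∀ j ∈ S, (C n *ᵥ p n) j = 0) (hTS : T ⊆ S) (hb : 0 < b) (hq : 0 < q)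
    (hpb : ∀ n, p n ⬝ᵥ C n *ᵥ p n ≤ b) (L : ℕ)
    {f : (Fin N → Fin d → ℝ) → EuclideanSpace ℝ (Fin N)}
    (hf : ∀ x, f (maskComponents S x) = f x) (hfm : Measurable f) :
    P {x | inner ℝ (orthResidual (blockSpan L T x) (f x)) (WithLp.toLp 2 (linearSeries p x)) <
        -(√(2 * b * q) * ‖orthResidual (blockSpan L T x) (f x)‖)} ≤
      ENNReal.ofReal (Real.exp (-q)) := by
  have h2 : Measurable fun z : (Fin N → Fin d → ℝ) × (Fin N → ℝ) =>
      (WithLp.toLp 2 z.2 : EuclideanSpace ℝ (Fin N)) :=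
    (WithLp.measurable_toLp 2 _).comp measurable_snd
  have hm : ∀ {y : (Fin N → Fin d → ℝ) × (Fin N → ℝ) → EuclideanSpace ℝ (Fin N)}, Measurable y →
      Measurable fun z => ‖orthResidual (blockSpan L T z.1) (y z)‖ := fun hy =>
    measurable_norm_orthResidual_blockSpan L T measurable_fst hy
  have h1 := h.linear_tail hp hb hq hpb (c := fun x => -orthResidual (blockSpan L T x) (f x))
    (fun x => by simp only [blockSpan_mask L hTS, hf])
    (by
      simp_rw [norm_neg]
      exact measurable_norm_orthResidual_blockSpan L T measurable_id hfm)
    (by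
      simp_rw [inner_neg_left, inner_orthResidual_eq]
      exact (((((hm (h2.add (hfm.comp measurable_fst))).pow_const 2).sub
        ((hm h2).pow_const 2)).sub ((hm (hfm.comp measurable_fst)).pow_const 2)).div_const 2).neg)
  refine (measure_mono fun x hx => ?_).trans h1
  simp only [Set.mem_ofPred_eq, inner_neg_left, norm_neg] at hx ⊢
  linarith

theorem sq_lower_tail (h : IsUncorrelatedGaussian P C) (hb : 0 < b) (hq : 0 < q)
    (hpb : ∀ n, p n ⬝ᵥ C n *ᵥ p n ≤ b) (hp0 : ∀ n, 0 ≤ p n ⬝ᵥ C n *ᵥ p n) :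
    P {x | ‖WithLp.toLp 2 (linearSeries p x)‖ ^ 2 <
        ∑ n, p n ⬝ᵥ C n *ᵥ p n - 2 * √(q * b * ∑ n, p n ⬝ᵥ C n *ᵥ p n)} ≤
      ENNReal.ofReal (Real.exp (-q)) := by
  have h1 := gaussianPi_sq_lower_tail (v := fun n => (p n ⬝ᵥ C n *ᵥ p n).toNNReal) (q := q) hb
    (fun n => by
      rw [Real.coe_toNNReal', max_le_iff]
      exact ⟨hpb n, hb.le⟩) hq
  rw [← h.map_linearSeries, Measure.map_apply (by fun_prop)
    (measurableSet_lt (by fun_prop) (by fun_prop))] at h1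
  refine (measure_mono fun x hx => ?_).trans h1
  simpa [EuclideanSpace.norm_sq_eq, Real.coe_toNNReal _ (hp0 _)] using hx

/-- This is the projection bound for the whole space, of dimension N. -/
theorem sq_upper_tail (h : IsUncorrelatedGaussian P C) (hb : 0 < b)
    (hpb : ∀ n, p n ⬝ᵥ C n *ᵥ p n ≤ b) :
    P {x | 4 * b * (N + q) < ‖WithLp.toLp 2 (linearSeries p x)‖ ^ 2} ≤
      ENNReal.ofReal (Real.exp (-q)) := by
  have h1 := gaussianPi_projection_tail (v := fun n => (p n ⬝ᵥ C n *ᵥ p n).toNNReal) (q := q) hb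
    (fun n => by
      rw [Real.coe_toNNReal', max_le_iff]
      exact ⟨hpb n, hb.le⟩) (⊤ : Submodule ℝ (EuclideanSpace ℝ (Fin N))) (K := N) (by simp)
  simp only [Submodule.starProjection_top'] at h1
  rw [← h.map_linearSeries, Measure.map_apply (by fun_prop)
    (measurableSet_lt (by fun_prop) (by fun_prop))] at h1
  exact h1

end IsUncorrelatedGaussian

end BlockSpan

/-! ### The variance estimate as a blockwise least squares error. -/

section CondVarEst

open scoped ENNReal NNReal Matrix

section SchurComplement

variable {κ : Type*} [Fintype κ] [DecidableEq κ] {M : Matrix κ κ ℝ}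

/-- The Schur complement is the minimum of the form over vectors with entry 1 at r: expand the form
at c - z/k, where z is column r of the inverse and k its entry at r. -/
theorem one_div_inv_apply_le (hM : M.IsSymm) (hpsd : ∀ v : κ → ℝ, 0 ≤ v ⬝ᵥ M *ᵥ v) {r : κ}
    {c : κ → ℝ} (hc : c r = 1) : 1 / M⁻¹ r r ≤ c ⬝ᵥ M *ᵥ c := by
  by_cases hdet : IsUnit M.det
  · set z := M⁻¹ *ᵥ Pi.single r 1 with hz
    have hMz : M *ᵥ z = Pi.single r 1 := by
      rw [hz, Matrix.mulVec_mulVec, Matrix.mul_nonsing_inv _ hdet, Matrix.one_mulVec]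
    have hzr : z r = M⁻¹ r r := by simp [hz]
    have hzz : z ⬝ᵥ M *ᵥ z = M⁻¹ r r := by rw [hMz]; simp [hzr]
    have hcz : c ⬝ᵥ M *ᵥ z = 1 := by rw [hMz]; simp [hc]
    set k := M⁻¹ r r
    have hk : 0 ≤ k := hzz ▸ hpsd z
    rcases hk.eq_or_lt with h0 | hpos
    · rw [← h0, div_zero]; exact hpsd c
    · have h1 := hpsd (c - (1 / k) • z)
      rw [Matrix.mulVec_sub, dotProduct_sub, sub_dotProduct, sub_dotProduct, Matrix.mulVec_smul,
        dotProduct_smul, smul_dotProduct, smul_dotProduct, dotProduct_smul, hzz, hcz,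
        hM.dotProduct_mulVec_comm z c, hcz] at h1
      simp only [smul_eq_mul] at h1
      have h2 : 1 / k * (1 / k * k) = 1 / k := by field_simp
      linarith
  -- A singular matrix has inverse `0`, and `1 / 0 = 0`, so the upper bound survives; the reverse
  -- inequality does not.
  · rw [Matrix.nonsing_inv_apply_not_isUnit _ hdet]
    simpa using hpsd c

theorem exists_eq_one_div_inv_apply (hpos : ∀ v : κ → ℝ, v ≠ 0 → 0 < v ⬝ᵥ M *ᵥ v) (r : κ) :
    ∃ c : κ → ℝ, c r = 1 ∧ c ⬝ᵥ M *ᵥ c = 1 / M⁻¹ r r := by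
  have hdet : IsUnit M.det := by
    rw [isUnit_iff_ne_zero]
    intro h0
    obtain ⟨v, hv, hv0⟩ := Matrix.exists_mulVec_eq_zero_iff.2 h0
    have := hpos v hv
    simp [hv0] at this
  set z := M⁻¹ *ᵥ Pi.single r 1 with hz
  have hMz : M *ᵥ z = Pi.single r 1 := by
    rw [hz, Matrix.mulVec_mulVec, Matrix.mul_nonsing_inv _ hdet, Matrix.one_mulVec]
  have hzr : z r = M⁻¹ r r := by simp [hz]
  have hz0 : z ≠ 0 := fun h0 => by
    rw [h0, Matrix.mulVec_zero] at hMz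
    have := congrFun hMz r
    simp at this
  have hk := hpos z hz0
  rw [hMz] at hk
  simp [hzr] at hk
  refine ⟨(1 / M⁻¹ r r) • z, by simp [hzr, hk.ne'], ?_⟩
  rw [Matrix.mulVec_smul, dotProduct_smul, smul_dotProduct, hMz]
  simp [hzr, hk.ne']

end SchurComplement

variable {N d : ℕ}

theorem blockSampleCov_isSymm (L : ℕ) (x : Fin N → Fin d → ℝ) (b : ℕ) :
    (blockSampleCov L x b).IsSymm := by
  ext i j
  simp only [Matrix.transpose_apply, blockSampleCov, Matrix.of_apply]
  simp_rw [mul_comm]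

theorem quadForm_blockSampleCov (L : ℕ) (x : Fin N → Fin d → ℝ) (b : ℕ) {κ : Type*} [Fintype κ]
    (f : κ → Fin d) (v : κ → ℝ) :
    v ⬝ᵥ (blockSampleCov L x b).submatrix f f *ᵥ v =
      1 / L * ∑ n : Fin N with n.val / L = b, (∑ i, v i * x n (f i)) ^ 2 := by
  simp only [dotProduct, Matrix.mulVec, Matrix.submatrix_apply, blockSampleCov, Matrix.of_apply,
    sq, Finset.mul_sum, Finset.sum_mul]
  symm
  rw [Finset.sum_comm]
  refine Finset.sum_congr rfl fun i _ => ?_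
  rw [Finset.sum_comm]
  exact Finset.sum_congr rfl fun j _ => Finset.sum_congr rfl fun n _ => by ring

theorem sum_eq_sum_blocks {L : ℕ} (hN : L ∣ N) (F : Fin N → ℝ) :
    ∑ n, F n = ∑ b ∈ Finset.range (N / L), ∑ n : Fin N with n.val / L = b, F n := by
  refine (Finset.sum_fiberwise_of_maps_to (fun n _ => ?_) F).symm
  rw [Finset.mem_range]
  exact Nat.div_lt_div_of_lt_of_dvd hN n.2

theorem mul_condVarEst_eq {L : ℕ} (hN : L ∣ N) (x : Fin N → Fin d → ℝ) (r : Fin d)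
    (T : Finset (Fin d)) :
    (N : ℝ) * condVarEst L x r T = ∑ b ∈ Finset.range (N / L), L *
      (1 / ((blockSampleCov L x b).submatrix
        (Subtype.val : ↥(insert r T) → Fin d) (Subtype.val : ↥(insert r T) → Fin d))⁻¹
      ⟨r, Finset.mem_insert_self r T⟩ ⟨r, Finset.mem_insert_self r T⟩) := by
  rw [condVarEst, ← Finset.mul_sum, ← mul_assoc]
  rcases Nat.eq_zero_or_pos (N / L) with h0 | hpos
  · simp [h0]
  · congr 1
    have h1 : (N : ℝ) = L * (N / L : ℕ) := by
      rw [← Nat.cast_mul, Nat.mul_div_cancel' hN]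
    have h2 : ((N / L : ℕ) : ℝ) ≠ 0 := by positivity
    rw [mul_one_div, div_eq_iff h2, h1]

/-- Least squares minimality, for arbitrary coefficients in each block. No nonsingularity is needed
for this direction. -/
theorem condVarEst_le {L : ℕ} (hL : 0 < L) (hN : L ∣ N) (x : Fin N → Fin d → ℝ) {r : Fin d}
    {T : Finset (Fin d)} (hr : r ∉ T) (c : ℕ → Fin d → ℝ) :
    (N : ℝ) * condVarEst L x r T ≤ ∑ n, (x n r - ∑ i ∈ T, c (n.val / L) i * x n i) ^ 2 := by
  rw [mul_condVarEst_eq hN, sum_eq_sum_blocks hN]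
  refine Finset.sum_le_sum fun b _ => ?_
  have hL' : (0 : ℝ) < L := by exact_mod_cast hL
  have h1 := one_div_inv_apply_le
    (M := (blockSampleCov L x b).submatrix
        (Subtype.val : ↥(insert r T) → Fin d) (Subtype.val : ↥(insert r T) → Fin d))
    ((blockSampleCov_isSymm L x b).submatrix _)
    (fun v => by
      rw [quadForm_blockSampleCov]
      positivity)
    (r := ⟨r, Finset.mem_insert_self r T⟩)
    (c := fun i => if (i : Fin d) = r then 1 else -c b i) (by simp)
  rw [quadForm_blockSampleCov] at h1
  refine (mul_le_mul_of_nonneg_left h1 hL'.le).trans_eq ?_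
  rw [← mul_assoc, mul_one_div_cancel hL'.ne', one_mul]
  refine Finset.sum_congr rfl fun n hn => ?_
  rw [Finset.mem_filter] at hn
  rw [hn.2, Finset.sum_coe_sort (insert r T) fun i => (if i = r then 1 else -c b i) * x n i,
    Finset.sum_insert hr]
  congr 1
  rw [if_pos rfl, one_mul, sub_eq_add_neg, ← Finset.sum_neg_distrib]
  congr 1
  refine Finset.sum_congr rfl fun i hi => ?_
  have hir : i ≠ r := fun h => hr (h ▸ hi)
  rw [if_neg hir]; ring

theorem exists_condVarEst_eq {L : ℕ} (hL : 0 < L) (hN : L ∣ N) (x : Fin N → Fin d → ℝ) {r : Fin d}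
    {T : Finset (Fin d)} (hr : r ∉ T)
    (hli : ∀ b < N / L, LinearIndepOn ℝ (blockColumn L x b) (insert r T : Finset (Fin d))) :
    ∃ c : ℕ → Fin d → ℝ,
      (N : ℝ) * condVarEst L x r T = ∑ n, (x n r - ∑ i ∈ T, c (n.val / L) i * x n i) ^ 2 := by
  have hL' : (0 : ℝ) < L := by exact_mod_cast hL
  have hblock : ∀ b, ∃ c : Fin d → ℝ, b < N / L → L *
      (1 / ((blockSampleCov L x b).submatrix
        (Subtype.val : ↥(insert r T) → Fin d) (Subtype.val : ↥(insert r T) → Fin d))⁻¹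
      ⟨r, Finset.mem_insert_self r T⟩ ⟨r, Finset.mem_insert_self r T⟩) =
      ∑ n : Fin N with n.val / L = b, (x n r - ∑ i ∈ T, c i * x n i) ^ 2 := by
    intro b
    by_cases hb : b < N / L
    swap
    · exact ⟨0, fun h => absurd h hb⟩
    obtain ⟨c, hc, hcM⟩ := exists_eq_one_div_inv_apply
      (M := (blockSampleCov L x b).submatrix
        (Subtype.val : ↥(insert r T) → Fin d) (Subtype.val : ↥(insert r T) → Fin d))
      (fun v hv => by
        rw [quadForm_blockSampleCov]
        refine mul_pos (by positivity) ?_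
        by_contra hle
        have hz : ∑ i, v i • blockColumn L x b i = 0 := by
          ext n
          by_cases hn : n.val / L = b
          · have h0 := (Finset.sum_eq_zero_iff_of_nonneg fun n _ => sq_nonneg _).1
              (le_antisymm (not_lt.1 hle) (Finset.sum_nonneg fun n _ => sq_nonneg
                (∑ i, v i * x n i))) n (by simp [hn])
            simpa [blockColumn, hn] using h0
          · simp [blockColumn, hn]
        have := Fintype.linearIndependent_iff.1 (hli b hb) v hz
        exact hv (funext this))
      ⟨r, Finset.mem_insert_self r T⟩
    refine ⟨fun i => if hi : i ∈ insert r T then -c ⟨i, hi⟩ else 0, fun _ => ?_⟩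
    rw [← hcM, quadForm_blockSampleCov, ← mul_assoc, mul_one_div_cancel hL'.ne', one_mul]
    refine Finset.sum_congr rfl fun n _ => ?_
    congr 1
    have h1 : ∑ i : ↥(insert r T), c i * x n i =
        ∑ i ∈ insert r T, (if hi : i ∈ insert r T then c ⟨i, hi⟩ else 0) * x n i := by
      rw [← Finset.sum_coe_sort (insert r T)]
      exact Finset.sum_congr rfl fun i _ => by simp
    rw [h1, Finset.sum_insert hr, dif_pos (Finset.mem_insert_self r T), hc, one_mul,
      sub_eq_add_neg, ← Finset.sum_neg_distrib]
    congr 1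
    refine Finset.sum_congr rfl fun i hi => ?_
    simp [hi]
  choose c hc using hblock
  refine ⟨c, ?_⟩
  rw [mul_condVarEst_eq hN, sum_eq_sum_blocks hN]
  refine Finset.sum_congr rfl fun b hb => ?_
  rw [hc b (Finset.mem_range.1 hb)]
  refine Finset.sum_congr rfl fun n hn => ?_
  rw [(Finset.mem_filter.1 hn).2]

/-- If the block sample covariances are nonsingular, the estimated conditional variance is at
least the squared distance to the span of the blockwise data. -/
theorem norm_orthResidual_sq_le_condVarEst {L : ℕ} (hL : 0 < L) (hN : L ∣ N)
    (x : Fin N → Fin d → ℝ) {r : Fin d} {T : Finset (Fin d)} (hr : r ∉ T)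
    (hli : ∀ b < N / L, LinearIndepOn ℝ (blockColumn L x b) (insert r T : Finset (Fin d))) :
    ‖orthResidual (blockSpan L T x) (WithLp.toLp 2 fun n => x n r)‖ ^ 2 ≤
      N * condVarEst L x r T := by
  obtain ⟨c, hc⟩ := exists_condVarEst_eq hL hN x hr hli
  set w : EuclideanSpace ℝ (Fin N) :=
    ∑ k : Fin (N / L) × T, c k.1 k.2 • blockColumn L x k.1 k.2 with hw
  have hwmem : w ∈ blockSpan L T x := Submodule.sum_mem _ fun k _ =>
    Submodule.smul_mem _ _ (Submodule.subset_span ⟨k, rfl⟩)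
  have h1 := norm_orthResidual_le (blockSpan L T x) (WithLp.toLp 2 fun n => x n r) hwmem
  have hwn : ∀ n, w n = ∑ i ∈ T, c (n.val / L) i * x n i := by
    intro n
    have hn : n.val / L < N / L := Nat.div_lt_div_of_lt_of_dvd hN n.2
    rw [hw, Fintype.sum_prod_type, WithLp.ofLp_sum, Finset.sum_apply,
      Finset.sum_eq_single ⟨n.val / L, hn⟩]
    · rw [← Finset.sum_coe_sort T]
      simp [blockColumn]
    · intro b _ hb
      have : n.val / L ≠ b := fun h => hb (Fin.ext h.symm)
      simp [blockColumn, this]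
    · simp
  rw [hc]
  refine (pow_le_pow_left₀ (norm_nonneg _) h1 2).trans_eq ?_
  rw [EuclideanSpace.norm_sq_eq]
  refine Finset.sum_congr rfl fun n _ => ?_
  rw [Real.norm_eq_abs, sq_abs, PiLp.sub_apply, hwn]

end CondVarEst

/-! ### Almost sure nonsingularity of the block sample covariances. -/

section Nonsingular

open scoped ENNReal NNReal Matrix

variable {N d : ℕ}

/-- The restriction of a time series to a block, extended by zero. -/
noncomputable def blockRestrict (L b : ℕ) (y : Fin N → ℝ) : EuclideanSpace ℝ (Fin N) :=
  WithLp.toLp 2 fun n => if n.val / L = b then y n else 0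

theorem measurable_blockRestrict (L b : ℕ) :
    Measurable (blockRestrict (N := N) L b) := by
  unfold blockRestrict
  refine (WithLp.measurable_toLp 2 _).comp (measurable_pi_lambda _ fun n => ?_)
  split_ifs <;> fun_prop

/-- The block has L coordinates, so some unit vector of the block lies outside V; its component
orthogonal to V is nonzero and stays in the block because V does. -/
theorem exists_block_vector_orthogonal {L b : ℕ} (hb : b < N / L)
    {V : Submodule ℝ (EuclideanSpace ℝ (Fin N))}
    (hV : ∀ v ∈ V, ∀ n : Fin N, n.val / L ≠ b → v n = 0) (hdim : Module.finrank ℝ V < L) :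
    ∃ c ∈ Vᗮ, c ≠ 0 ∧ ∀ n : Fin N, n.val / L ≠ b → c n = 0 := by
  have hL : 0 < L := by omega
  have hidx : ∀ k : Fin L, b * L + k < N := fun k => by
    have h1 : (b + 1) * L ≤ N / L * L := Nat.mul_le_mul_right L hb
    have h2 := Nat.div_mul_le_self N L
    have h3 := k.2
    rw [add_mul] at h1
    omega
  let ix : Fin L → Fin N := fun k => ⟨b * L + k, hidx k⟩
  have hix : Function.Injective ix := fun k k' h => by
    have := congrArg Fin.val h
    simp only [ix] at this
    exact Fin.ext (by omega)
  have hex : ∃ k, EuclideanSpace.single (ix k) (1 : ℝ) ∉ V := by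
    by_contra hall
    push Not at hall
    have hli : LinearIndependent ℝ fun k => (⟨EuclideanSpace.single (ix k) (1 : ℝ), hall k⟩ : V) := by
      have h1 : LinearIndependent ℝ fun k => EuclideanSpace.single (ix k) (1 : ℝ) :=
        ((EuclideanSpace.orthonormal_single (𝕜 := ℝ) (ι := Fin N)).linearIndependent).comp ix hix
      exact LinearIndependent.of_comp V.subtype h1
    have := hli.fintype_card_le_finrank
    simp at this
    omega
  obtain ⟨k, hk⟩ := hex
  refine ⟨orthResidual V (EuclideanSpace.single (ix k) 1), orthResidual_mem_orthogonal V _,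
    fun h => hk ((orthResidual_eq_zero_iff V).1 h), fun n hn => ?_⟩
  have hne : n ≠ ix k := by
    rintro rfl
    apply hn
    simp only [ix]
    rw [mul_comm, Nat.mul_add_div hL, Nat.div_eq_of_lt k.2, add_zero]
  rw [orthResidual, PiLp.sub_apply, hV _ (V.starProjection_apply_mem _) n hn]
  simp [hne]

namespace IsUncorrelatedGaussian

variable {P : Measure (Fin N → Fin d → ℝ)} {C : Fin N → Matrix (Fin d) (Fin d) ℝ}

/-- Conditionally on the components other than r, the series p·x has independent nondegenerate
Gaussian entries, and membership of the column in a space of dimension less than L imposes a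
nontrivial linear equation on them. Such a hyperplane is a null set. -/
theorem ae_blockColumn_notMem_span (h : IsUncorrelatedGaussian P C) {l u : ℝ} (hl : 0 < l)
    (hC : ∀ n, QuadBounded (C n) l u) {L b : ℕ} (hb : b < N / L)
    {T : Finset (Fin d)} (hT : T.card < L) {r : Fin d} (hr : r ∉ T) :
    ∀ᵐ x ∂P, blockColumn L x b r ∉ Submodule.span ℝ (Set.range fun i : T => blockColumn L x b i) := by
  set p : Fin N → Fin d → ℝ := fun n => residualCoeff (C n) r with hp
  set S : Finset (Fin d) := {r}ᶜ with hS
  have hTS : T ⊆ S := fun i hi => by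
    rw [hS, Finset.mem_compl, Finset.mem_singleton]
    exact fun h => hr (h ▸ hi)
  let V : (Fin N → Fin d → ℝ) → Submodule ℝ (EuclideanSpace ℝ (Fin N)) := fun x =>
    Submodule.span ℝ (Set.range fun i : T => blockColumn L x b i)
  have hVmask : ∀ x, V (maskComponents S x) = V x := fun x => by
    have : (fun i : T => blockColumn L (maskComponents S x) b i) =
        fun i : T => blockColumn L x b i := funext fun i => blockColumn_mask L x b (hTS i.2)
    simp only [V, this]
  -- As p has entry 1 at r, x_r is p·x minus a combination of the other components, which the mask
  -- retains.
  have hcol : ∀ x, blockColumn L x b r =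
      blockRestrict L b (linearSeries p x - linearSeries p (maskComponents S x)) := by
    intro x
    ext n
    simp only [blockColumn, blockRestrict]
    split_ifs
    · simp only [Pi.sub_apply, linearSeries]
      rw [← dotProduct_sub, dotProduct, Finset.sum_eq_single r]
      · simp [hp, maskComponents, hS, (hC n).residualCoeff_self hl]
      · intro i _ hi
        simp [maskComponents, hS, hi]
      · simp
    · rfl
  let A : Set ((Fin N → Fin d → ℝ) × (Fin N → ℝ)) :=
    {z | blockRestrict L b (z.2 - linearSeries p (maskComponents S z.1)) ∈ V z.1}
  have hAmeas : MeasurableSet A := by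
    have hy : Measurable fun z : (Fin N → Fin d → ℝ) × (Fin N → ℝ) =>
        blockRestrict L b (z.2 - linearSeries p (maskComponents S z.1)) :=
      (measurable_blockRestrict L b).comp (measurable_snd.sub
        ((measurable_linearSeries p).comp ((measurable_maskComponents S).comp measurable_fst)))
    have hm := measurable_norm_orthResidual
      (φ := fun (i : T) (z : (Fin N → Fin d → ℝ) × (Fin N → ℝ)) => blockColumn L z.1 b i)
      (fun i => (measurable_blockColumn L b (i : Fin d)).comp measurable_fst) hy
    convert! hm (measurableSet_singleton 0) using 1
    ext z
    simp only [A, V, Set.mem_ofPred_eq, Set.mem_preimage, Set.mem_singleton_iff, norm_eq_zero,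
      orthResidual_eq_zero_iff]
  have hmm : ∀ x : Fin N → Fin d → ℝ, maskComponents S (maskComponents S x) = maskComponents S x :=
    fun x => by
      ext n i
      by_cases hi : i ∈ S <;> simp [maskComponents, hi]
  have hzero := h.measure_le_of_conditional S (p := p) (fun n j hj => by
      rw [hp, (hC n).mulVec_residualCoeff hl, Pi.single_eq_of_ne]
      simpa [hS] using hj) hAmeas
    (fun x y => by simp only [A, Set.mem_ofPred_eq, hVmask, hmm]) (c := 0) (fun z => by
      obtain ⟨c, hcV, hc0, hcb⟩ := exists_block_vector_orthogonal hb (V := V z)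
        (fun v hv n hn => by
          refine Submodule.span_induction (p := fun v _ => v n = 0) ?_ ?_ ?_ ?_ hv
          · rintro _ ⟨i, rfl⟩
            simp [blockColumn, hn]
          · simp
          · intro v w _ _ hv hw
            simp [hv, hw]
          · intro t v _ hv
            simp [hv])
        ((finrank_range_le_card _).trans_lt (by simpa using hT))
      have hc0' : (fun n => c n) ≠ 0 := fun h0 => hc0 (by ext n; exact congrFun h0 n)
      rw [nonpos_iff_eq_zero]
      refine measure_mono_null (fun y hy => ?_) (gaussianPi_hyperplane_eq_zero
        (v := fun n => (p n ⬝ᵥ C n *ᵥ p n).toNNReal) (fun n => ?_) hc0'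
        (∑ n, c n * linearSeries p (maskComponents S z) n))
      · have h1 := hcV _ hy
        simp only [PiLp.inner_apply, blockRestrict, Set.mem_ofPred_eq] at h1 ⊢
        rw [← sub_eq_zero, ← Finset.sum_sub_distrib, ← h1]
        refine Finset.sum_congr rfl fun n _ => ?_
        by_cases hn : n.val / L = b
        · simp [hn]; ring
        · simp [hcb n hn]
      · rw [Ne, Real.toNNReal_eq_zero, not_le]
        refine (hC n).pos hl fun h0 => ?_
        have := congrFun h0 r
        simp [hp, (hC n).residualCoeff_self hl] at this)
  rw [ae_iff]
  refine measure_mono_null (fun x hx => ?_) (nonpos_iff_eq_zero.1 hzero)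
  simp only [Set.mem_ofPred_eq, not_not, A] at hx ⊢
  rw [hcol] at hx
  exact hx

theorem ae_linearIndepOn_blockColumn (h : IsUncorrelatedGaussian P C) {l u : ℝ} (hl : 0 < l)
    (hC : ∀ n, QuadBounded (C n) l u) {L b : ℕ} (hb : b < N / L)
    (T : Finset (Fin d)) (hT : T.card ≤ L) :
    ∀ᵐ x ∂P, LinearIndepOn ℝ (blockColumn L x b) (T : Set (Fin d)) := by
  induction T using Finset.induction_on with
  | empty => simp
  | insert r T hr ih =>
    rw [Finset.card_insert_of_notMem hr] at hT
    filter_upwards [ih (by omega), h.ae_blockColumn_notMem_span hl hC hb (T := T) (by omega) hr]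
      with x h1 h2
    rw [Finset.coe_insert]
    refine h1.insert ?_
    rwa [Set.image_eq_range]

end IsUncorrelatedGaussian

end Nonsingular

/-! ### Deterministic accounting: the gain against all error terms. -/

section Margins

theorem two_mul_mul_le_add_div {θ a b : ℝ} (hθ : 0 < θ) : 2 * a * b ≤ θ * a ^ 2 + b ^ 2 / θ := by
  have h : θ * a ^ 2 + b ^ 2 / θ - 2 * a * b = (θ * a - b) ^ 2 / θ := by field_simp; ring
  have : 0 ≤ (θ * a - b) ^ 2 / θ := by positivity
  linarith

/-- The gap between the empirical conditional variances for a set that misses neighbors. -/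
theorem margin_of_missing {β ε N ρ q K τ D w y H E m : ℝ} (hβ : 0 < β) (hε : 0 < ε)
    (hεβ : ε * β * (36 * β ^ 2 + 8 * β + 16) ≤ 1 / 2) (hN : 0 < N) (hρ : 0 < ρ)
    (hq : 0 < q) (hqN : q ≤ ε * ρ ^ 3 * N) (hqN' : q ≤ N) (hK : 0 ≤ K) (hKN : K ≤ ε * ρ ^ 2 * N)
    (hτ0 : 0 ≤ τ) (hτ : τ ≤ ε * ρ ^ 2)
    (hy : y ^ 2 ≤ 4 * τ * (N + q))
    (hD : w ^ 2 - 2 * √(2 * β * q) * w - 4 * β * (K + q) - y ^ 2 - 2 * √(2 * β * q) * y ≤ D)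
    (hE : N * m * ρ + E ^ 2 / (N * β) ≤ E) (hm : 1 ≤ m)
    (hH : E - 2 * √(q * β * E) ≤ H) (hw : H - 4 * β * (K + q) - 2 * β * q ≤ w ^ 2) :
    N * m * ρ < D := by
  have hNρ : N * ρ ≤ N * m * ρ := by nlinarith [mul_pos hN hρ]
  have hE2 : 0 ≤ E ^ 2 / (N * β) := by positivity
  have hEN : N * ρ ≤ E := by linarith
  have hE0 : 0 < E := lt_of_lt_of_le (mul_pos hN hρ) hEN
  obtain ⟨e, rfl⟩ : ∃ e, E = N * e := ⟨E / N, by field_simp⟩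
  have heρ : ρ ≤ e := le_of_mul_le_mul_left hEN hN
  have he0 : 0 < e := hρ.trans_le heρ
  have hEe : (N * e) ^ 2 / (N * β) = N * (e ^ 2 / β) := by field_simp
  rw [hEe] at hE
  have heβ : e ≤ β := by
    have h1 : N * (e ^ 2 / β) ≤ N * e := by nlinarith [mul_pos (mul_pos hN (by linarith : 0 < m)) hρ]
    have h2 : e ^ 2 / β ≤ e := le_of_mul_le_mul_left h1 hN
    rw [div_le_iff₀ hβ] at h2
    nlinarith
  -- With e the excess per unit of time, this weight makes θE an eighth of the surplus Ne²/β, so a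
  -- linear fluctuation in w costs only a fraction of it.
  set θ := e / (8 * β) with hθdef
  have hθ : 0 < θ := by positivity
  have hθ1 : θ ≤ 1 / 8 := by
    rw [hθdef, div_le_iff₀ (by positivity)]; linarith
  have hs : √(2 * β * q) ^ 2 = 2 * β * q := Real.sq_sqrt (by positivity)
  have hs' : √(q * β * (N * e)) ^ 2 = q * β * (N * e) := Real.sq_sqrt (by positivity)
  have h1 := two_mul_mul_le_add_div (a := w) (b := √(2 * β * q)) hθ
  have h2 := two_mul_mul_le_add_div (a := y) (b := √(2 * β * q)) one_pos
  rw [hs] at h1 h2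
  have h3 : 2 * √(q * β * (N * e)) ≤ θ * (N * e) + q * β / θ := by
    have hr : √(q * β * (N * e)) = √(N * e) * √(q * β) := by
      rw [mul_comm, Real.sqrt_mul hE0.le]
    have := two_mul_mul_le_add_div (a := √(N * e)) (b := √(q * β)) hθ
    rw [Real.sq_sqrt hE0.le, Real.sq_sqrt (by positivity)] at this
    rw [hr]; linarith
  -- The cubic requirement q ≤ ερ³N is needed here: q/e has to be dominated by Ne², and e can be as
  -- small as ρ.
  have hqθ : q * β / θ ≤ 8 * β ^ 2 * ε * (N * e ^ 2) := by
    have : q * β / θ = 8 * β ^ 2 * (q / e) := by rw [hθdef]; field_simp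
    rw [this]
    have h4 : q / e ≤ ε * (N * e ^ 2) := by
      rw [div_le_iff₀ he0]
      calc q ≤ ε * ρ ^ 3 * N := hqN
        _ ≤ ε * e ^ 3 * N := by gcongr
        _ = _ := by ring
    nlinarith [mul_le_mul_of_nonneg_left h4 (by positivity : 0 ≤ 8 * β ^ 2)]
  have hq2 : q * β ≤ β ^ 2 * ε * (N * e ^ 2) := by
    calc q * β ≤ ε * ρ ^ 3 * N * β := by gcongr
      _ ≤ ε * (β * e ^ 2) * N * β := by
        have : ρ ^ 3 ≤ β * e ^ 2 := by
          calc ρ ^ 3 ≤ e ^ 3 := by gcongr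
            _ = e * e ^ 2 := by ring
            _ ≤ _ := by gcongr
        gcongr
      _ = _ := by ring
  have hK2 : K * β ≤ β * ε * (N * e ^ 2) := by
    calc K * β ≤ ε * ρ ^ 2 * N * β := by gcongr
      _ ≤ ε * e ^ 2 * N * β := by gcongr
      _ = _ := by ring
  have hy2 : y ^ 2 ≤ 8 * ε * (N * e ^ 2) := by
    calc y ^ 2 ≤ 4 * τ * (N + q) := hy
      _ ≤ 4 * τ * (N + N) := by gcongr
      _ = 8 * N * τ := by ring
      _ ≤ 8 * N * (ε * ρ ^ 2) := by gcongr
      _ ≤ 8 * N * (ε * e ^ 2) := by gcongr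
      _ = _ := by ring
  have hA : 0 < N * e ^ 2 := by positivity
  have hθE : θ * (N * e) = N * (e ^ 2 / β) / 8 := by rw [hθdef]; field_simp
  -- In units of εNe², three terms qβ/θ cost 24β², the terms 12βq cost 12β², 8βK costs 8β, and 2y²
  -- costs 16. Together they take half of the surplus and 2θE takes a quarter, so strict inequality
  -- remains.
  have hX : (N * e ^ 2) * (ε * (36 * β ^ 2 + 8 * β + 16)) ≤ N * (e ^ 2 / β) / 2 := by
    have h5 : ε * (36 * β ^ 2 + 8 * β + 16) ≤ 1 / (2 * β) := by
      rw [le_div_iff₀ (by positivity)]; linarith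
    calc _ ≤ (N * e ^ 2) * (1 / (2 * β)) := by gcongr
      _ = _ := by field_simp
  have hG : 0 < N * (e ^ 2 / β) := by positivity
  have hwlow : (1 - θ) * w ^ 2 ≥ (1 - θ) * (N * e) - (θ * (N * e) + q * β / θ)
      - 4 * β * (K + q) - 2 * β * q := by
    have h6 : N * e - (θ * (N * e) + q * β / θ) - 4 * β * (K + q) - 2 * β * q ≤ w ^ 2 := by linarith
    have h7 : 0 ≤ q * β / θ := by positivity
    have h8 : 0 ≤ 4 * β * (K + q) := by positivity
    have h9 : 0 ≤ 2 * β * q := by positivity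
    have gen : ∀ A B D E W : ℝ, 0 ≤ A → 0 ≤ B → 0 ≤ D → E - A - B - D ≤ W →
        (1 - θ) * E - A - B - D ≤ (1 - θ) * W := by
      intro A B D E W hA hB hD h
      have h10 := mul_le_mul_of_nonneg_left h (by linarith : 0 ≤ 1 - θ)
      have h11 : 0 ≤ θ * (A + B + D) := by positivity
      linarith
    exact gen _ _ _ _ _ (by positivity) h8 h9 h6
  have h2q : 2 * β * q / θ = 2 * (q * β / θ) := by ring
  rw [h2q] at h1
  linarith

/-- The gap between the empirical conditional variances for a superset of the neighborhood. -/
theorem margin_of_superset {β ε N ρ q K τ D w y : ℝ} (hβ : 0 < β) (hε : 0 < ε)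
    (hεβ : ε * β * (36 * β ^ 2 + 8 * β + 16) ≤ 1 / 2) (hN : 0 < N) (hρ : 0 < ρ) (hρβ : ρ ≤ β)
    (hq : 0 < q) (hqN : q ≤ ε * ρ ^ 3 * N) (hqN' : q ≤ N) (hKN : K ≤ ε * ρ ^ 2 * N)
    (hτ0 : 0 ≤ τ) (hτ : τ ≤ ε * ρ ^ 2)
    (hy : y ^ 2 ≤ 4 * τ * (N + q))
    (hD : w ^ 2 - 2 * √(2 * β * q) * w - 4 * β * (K + q) - y ^ 2 - 2 * √(2 * β * q) * y ≤ D) :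
    -(N * ρ) < D := by
  have hs : √(2 * β * q) ^ 2 = 2 * β * q := Real.sq_sqrt (by positivity)
  have h1 := two_mul_mul_le_add_div (a := w) (b := √(2 * β * q)) one_pos
  have h2 := two_mul_mul_le_add_div (a := y) (b := √(2 * β * q)) one_pos
  rw [hs] at h1 h2
  have hq2 : q * β ≤ β ^ 2 * ε * (N * (ρ * β)) := by
    calc q * β ≤ ε * ρ ^ 3 * N * β := by gcongr
      _ = ε * (ρ * (ρ * ρ)) * N * β := by ring
      _ ≤ ε * (ρ * (β * β)) * N * β := by gcongr
      _ = _ := by ring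
  have hρ2 : ρ ^ 2 ≤ ρ * β := by rw [sq]; gcongr
  have hK2 : K * β ≤ β * ε * (N * (ρ * β)) := by
    calc K * β ≤ ε * ρ ^ 2 * N * β := by gcongr
      _ ≤ ε * (ρ * β) * N * β := by gcongr
      _ = _ := by ring
  have hy2 : y ^ 2 ≤ 8 * ε * (N * (ρ * β)) := by
    calc y ^ 2 ≤ 4 * τ * (N + q) := hy
      _ ≤ 4 * τ * (N + N) := by gcongr
      _ = 8 * N * τ := by ring
      _ ≤ 8 * N * (ε * ρ ^ 2) := by gcongr
      _ ≤ 8 * N * (ε * (ρ * β)) := by gcongr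
      _ = _ := by ring
  have hX : (N * ρ) * (ε * β * (36 * β ^ 2 + 8 * β + 16)) ≤ (N * ρ) * (1 / 2) := by gcongr
  have hA : 0 < N * ρ := by positivity
  have hB : 0 ≤ N * ρ * ε * β ^ 3 := by positivity
  have hC : 0 ≤ N * ρ * ε * β ^ 2 := by positivity
  nlinarith

end Margins

/-! ### Lower tail for the distance of a signal plus independent noise. -/

section NeighborhoodSelection

open scoped ENNReal NNReal Matrix

variable {N d : ℕ}

theorem QuadBounded.mono {ι : Type*} [Fintype ι] {C : Matrix ι ι ℝ} {a b a' b' : ℝ}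
    (h : QuadBounded C a b) (ha : a' ≤ a) (hb : b ≤ b') : QuadBounded C a' b' := by
  have h0 : ∀ v : ι → ℝ, 0 ≤ v ⬝ᵥ v := fun v => by
    rw [dotProduct_self_eq_sum_sq]; positivity
  exact ⟨h.symm, fun v => (mul_le_mul_of_nonneg_right ha (h0 v)).trans (h.lower v),
    fun v => (h.upper v).trans (mul_le_mul_of_nonneg_right hb (h0 v))⟩

theorem linearSeries_mask {S : Finset (Fin d)} {p : Fin N → Fin d → ℝ}
    (hp : ∀ n, ∀ i ∉ S, p n i = 0) (x : Fin N → Fin d → ℝ) :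
    linearSeries p (maskComponents S x) = linearSeries p x := by
  ext n
  simp only [linearSeries, dotProduct]
  refine Finset.sum_congr rfl fun i _ => ?_
  by_cases hi : i ∈ S
  · simp [maskComponents, hi]
  · simp [hp n i hi]

theorem linearSeries_add (p p' : Fin N → Fin d → ℝ) (x : Fin N → Fin d → ℝ) :
    linearSeries (p + p') x = linearSeries p x + linearSeries p' x := by
  ext n
  simp [linearSeries, add_dotProduct]

theorem measurable_toLp_linearSeries (p : Fin N → Fin d → ℝ) :
    Measurable fun x => (WithLp.toLp 2 (linearSeries p x) : EuclideanSpace ℝ (Fin N)) :=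
  (WithLp.measurable_toLp 2 _).comp (measurable_linearSeries p)

namespace IsUncorrelatedGaussian

variable {P : Measure (Fin N → Fin d → ℝ)} {C : Fin N → Matrix (Fin d) (Fin d) ℝ}

/-- With the regression residuals written as `p · x`, the distance from a time series
`p · x + f` to the blockwise span of components outside which `p · x` is independent. -/
theorem norm_orthResidual_add_tail (h : IsUncorrelatedGaussian P C) {p f : Fin N → Fin d → ℝ}
    {S T : Finset (Fin d)} {b q K : ℝ} (hp : ∀ n, ∀ j ∈ S, (C n *ᵥ p n) j = 0) (hTS : T ⊆ S)
    (hf : ∀ n, ∀ i ∉ S, f n i = 0) (hb : 0 < b) (hq : 0 < q)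
    (hpb : ∀ n, p n ⬝ᵥ C n *ᵥ p n ≤ b) (L : ℕ) (hK : ((N / L * T.card : ℕ) : ℝ) ≤ K) :
    P {x | ‖orthResidual (blockSpan L T x) (WithLp.toLp 2 (linearSeries (p + f) x))‖ ^ 2 <
        ‖WithLp.toLp 2 (linearSeries p x)‖ ^ 2 +
        ‖orthResidual (blockSpan L T x) (WithLp.toLp 2 (linearSeries f x))‖ ^ 2 -
        2 * √(2 * b * q) *
          ‖orthResidual (blockSpan L T x) (WithLp.toLp 2 (linearSeries f x))‖ -
        4 * b * (K + q)} ≤ 2 * ENNReal.ofReal (Real.exp (-q)) := by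
  have h1 := h.projection_tail (q := q) hp hTS hb hpb L hK
  have h2 := h.linear_residual_tail hp hTS hb hq hpb L
    (f := fun x => WithLp.toLp 2 (linearSeries f x))
    (fun x => by rw [linearSeries_mask hf]) (measurable_toLp_linearSeries f)
  rw [two_mul (ENNReal.ofReal _)]
  refine le_trans (measure_mono fun x hx => ?_) ((measure_union_le _ _).trans (add_le_add h1 h2))
  simp only [Set.mem_union, Set.mem_ofPred_eq] at hx ⊢
  by_contra hcon
  push Not at hcon
  rw [linearSeries_add, WithLp.toLp_add, norm_orthResidual_add_sq] at hx
  linarith [hcon.1, hcon.2]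

end IsUncorrelatedGaussian

end NeighborhoodSelection

/-! ### Comparing one competing set with the true neighborhood. -/

section SelectionError

open scoped ENNReal NNReal Matrix

variable {N d : ℕ}

/-- The first time in the block of `n`. -/
def blockStart (L : ℕ) (n : Fin N) : Fin N :=
  ⟨L * (n.val / L), (Nat.mul_div_le _ _).trans_lt n.2⟩

theorem blockStart_div {L : ℕ} (hL : 0 < L) (n : Fin N) :
    (blockStart L n).val / L = n.val / L := by
  simp [blockStart, Nat.mul_div_cancel_left _ hL]

/-- Blockwise least squares requires coefficients constant on each block; those at the first time of
the block serve as a competitor. -/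
theorem condVarEst_le_of_blockStart {L : ℕ} (hL : 0 < L) (hN : L ∣ N) (x : Fin N → Fin d → ℝ)
    {r : Fin d} {T : Finset (Fin d)} (hr : r ∉ T) {p : Fin N → Fin d → ℝ} (hpr : ∀ n, p n r = 1)
    (hp : ∀ n j, j ≠ r → j ∉ T → p n j = 0) :
    (N : ℝ) * condVarEst L x r T ≤
      ‖(WithLp.toLp 2 (linearSeries (fun n => p (blockStart L n)) x) :
        EuclideanSpace ℝ (Fin N))‖ ^ 2 := by
  refine (condVarEst_le hL hN x hr
    (fun b i => if hb : L * b < N then -p ⟨L * b, hb⟩ i else 0)).trans_eq ?_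
  rw [EuclideanSpace.norm_sq_eq]
  refine Finset.sum_congr rfl fun n _ => ?_
  rw [Real.norm_eq_abs, sq_abs]
  congr 1
  have hb : L * (n.val / L) < N := (blockStart L n).2
  simp only [linearSeries, dotProduct, dif_pos hb]
  rw [← Finset.sum_subset (Finset.subset_univ (insert r T)), Finset.sum_insert hr, hpr, one_mul,
    sub_eq_add_neg, ← Finset.sum_neg_distrib]
  · congr 1
    exact Finset.sum_congr rfl fun i _ => by simp [blockStart]
  · intro i _ hi
    rw [Finset.mem_insert, not_or] at hi
    rw [hp _ i hi.1 hi.2, zero_mul]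

/-- The excess conditional variances, summed over time, exceed the penalty of the missing
neighbors by a quadratic term. -/
theorem sum_excess {C : Fin N → Matrix (Fin d) (Fin d) ℝ} {α : Fin N → ℝ} {β ρ : ℝ}
    (hβ : 0 < β) (hN : 0 < N) (hα : ∀ n, 0 < α n) (hC : ∀ n, QuadBounded (C n) (α n) β)
    {r : Fin d} {T M : Finset (Fin d)} (hrT : r ∉ T) (hrM : r ∉ M) (hMT : Disjoint M T)
    (hρ : ∀ j ∈ M, ρ ≤ partialCorr α C r j) {g : Fin N → Fin d → ℝ}
    (hg : ∀ n, ∀ i ∉ T, g n i = 0)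
    (hgT : ∀ n, ∀ j ∈ T, (C n *ᵥ (Pi.single r 1 - residualCoeff (C n) r - g n)) j = 0)
    {E : ℝ} (hE : E = ∑ n, (Pi.single r 1 - residualCoeff (C n) r - g n) ⬝ᵥ
      C n *ᵥ (Pi.single r 1 - residualCoeff (C n) r - g n)) :
    N * M.card * ρ + E ^ 2 / (N * β) ≤ E := by
  set e : Fin N → ℝ := fun n => (Pi.single r 1 - residualCoeff (C n) r - g n) ⬝ᵥ
      C n *ᵥ (Pi.single r 1 - residualCoeff (C n) r - g n) with he
  have hN' : (0 : ℝ) < N := by exact_mod_cast hN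
  have h1 : ∀ n, α n * ∑ j ∈ M, residualCoeff (C n) r j ^ 2 + e n ^ 2 / β ≤ e n := by
    intro n
    have := (hC n).excess (hα n) hβ hrT hMT ((hC n).residualCoeff_self (hα n) r)
      ((hC n).mulVec_residualCoeff (hα n) r) (hg n) (hgT n)
    refine le_trans (le_of_eq ?_) this
    congr 2
    refine Finset.sum_congr rfl fun j hj => ?_
    have hjr : j ≠ r := fun h => hrM (h ▸ hj)
    rw [if_neg hjr]
  have h2 : ∑ n, α n * ∑ j ∈ M, residualCoeff (C n) r j ^ 2 = N * ∑ j ∈ M, partialCorr α C r j := by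
    simp only [partialCorr, Finset.mul_sum]
    rw [Finset.sum_comm]
    refine Finset.sum_congr rfl fun j _ => Finset.sum_congr rfl fun n _ => ?_
    rw [residualCoeff]; field_simp
  have h3 : N * M.card * ρ ≤ N * ∑ j ∈ M, partialCorr α C r j := by
    rw [mul_assoc]
    refine mul_le_mul_of_nonneg_left ?_ hN'.le
    rw [← nsmul_eq_mul]
    exact Finset.card_nsmul_le_sum _ _ _ hρ
  have h4 : E ^ 2 / (N * β) ≤ ∑ n, e n ^ 2 / β := by
    have := sq_sum_le_card_mul_sum_sq (s := Finset.univ) (f := e)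
    rw [Finset.card_univ, Fintype.card_fin, ← hE] at this
    rw [← Finset.sum_div, div_le_div_iff₀ (by positivity) hβ]
    nlinarith
  have h5 := Finset.sum_le_sum fun n (_ : n ∈ Finset.univ) => h1 n
  rw [Finset.sum_add_distrib, h2, ← hE] at h5
  linarith

namespace IsUncorrelatedGaussian

variable {P : Measure (Fin N → Fin d → ℝ)} {C : Fin N → Matrix (Fin d) (Fin d) ℝ}

/-- The probability that a set other than the neighborhood of `r` has an objective that is not
larger than that of the neighborhood. -/
theorem selection_error_le (h : IsUncorrelatedGaussian P C) {α : Fin N → ℝ}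
    {α₀ β ρ ε q K η : ℝ} {L : ℕ} {r : Fin d} {Nb T : Finset (Fin d)}
    (hα₀ : 0 < α₀) (hα : ∀ n, α₀ ≤ α n) (hβ : 0 < β) (hC : ∀ n, QuadBounded (C n) (α n) β)
    (hrN : r ∉ Nb) (hNb : ∀ n j, j ≠ r → j ∉ Nb → (C n)⁻¹ r j = 0)
    (hρNb : ∀ j ∈ Nb, ρ ≤ partialCorr α C r j) (hrT : r ∉ T) (hTN : T ≠ Nb)
    (hN : 0 < N) (hL : 0 < L) (hLN : L ∣ N) (hTL : T.card + 1 ≤ L)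
    (hη : 0 < η) (hCη : ∀ n n' : Fin N, n.val / L = n'.val / L → ∀ i, ∑ j, |(C n - C n') i j| ≤ η)
    (hε : 0 < ε) (hεβ : ε * β * (36 * β ^ 2 + 8 * β + 16) ≤ 1 / 2)
    (hρ : 0 < ρ) (hρβ : ρ ≤ β) (hq : 0 < q) (hqN : q ≤ ε * ρ ^ 3 * N) (hqN' : q ≤ N)
    (hK : ((N / L * T.card : ℕ) : ℝ) ≤ K) (hKN : K ≤ ε * ρ ^ 2 * N)
    (hτ : β * (η ^ 2 * β / α₀ ^ 3) ≤ ε * ρ ^ 2) :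
    P {x | condVarEst L x r T + T.card * ρ ≤ condVarEst L x r Nb + Nb.card * ρ} ≤
      7 * ENNReal.ofReal (Real.exp (-q)) := by
  have hN' : (0 : ℝ) < N := by exact_mod_cast hN
  have hα' : ∀ n, 0 < α n := fun n => hα₀.trans_le (hα n)
  have hC₀ : ∀ n, QuadBounded (C n) α₀ β := fun n => (hC n).mono (hα n) le_rfl
  have hK0 : 0 ≤ K := le_trans (by positivity) hK
  set p : Fin N → Fin d → ℝ := fun n => residualCoeff (C n) r with hp
  have hpr : ∀ n, p n r = 1 := fun n => (hC n).residualCoeff_self (hα' n) r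
  have hCp : ∀ n, C n *ᵥ p n = Pi.single r (1 / (C n)⁻¹ r r) := fun n =>
    (hC n).mulVec_residualCoeff (hα' n) r
  have hp0 : ∀ n j, j ≠ r → j ∉ Nb → p n j = 0 := fun n j h1 h2 => by
    simp only [hp, residualCoeff, hNb n j h1 h2, zero_div]
  have hpb : ∀ n, p n ⬝ᵥ C n *ᵥ p n ≤ β := fun n => by
    have := (hC n).regression_norm_le (hα' n) (hpr n) (hCp n)
    rw [← this.1]; exact this.2.1
  set a : Fin N → Fin d → ℝ := fun n => Pi.single r 1 - p n with ha
  have har : ∀ n, a n r = 0 := fun n => by simp [ha, hpr]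
  have hS : ∀ i, i ∉ ({r}ᶜ : Finset (Fin d)) ↔ i = r := fun i => by simp
  have hpS : ∀ n, ∀ j ∈ ({r}ᶜ : Finset (Fin d)), (C n *ᵥ p n) j = 0 := fun n j hj => by
    rw [hCp, Pi.single_eq_of_ne]; simpa using hj
  have hTS : T ⊆ {r}ᶜ := fun i hi => by
    rw [Finset.mem_compl, Finset.mem_singleton]
    exact fun h => hrT (h ▸ hi)
  -- The signal a·x splits into g·x, its regression on the components in T, and v·x, which is
  -- independent of those components. As g varies within a block, g·x need not lie in the blockwise
  -- span.
  choose g hg hgT using fun n => (hC n).exists_regression (hα' n) T (a n)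
  set v : Fin N → Fin d → ℝ := fun n => a n - g n with hv
  have hvg : v + g = a := by ext n i; simp [hv]
  have hpa : ∀ x : Fin N → Fin d → ℝ, linearSeries (p + a) x = fun n => x n r := by
    intro x
    ext n
    simp [linearSeries, ha]
  -- The drift of the regression vector within a block. It vanishes at r, so pd·x is independent of
  -- p·x.
  set pd : Fin N → Fin d → ℝ := fun n => p (blockStart L n) - p n with hpd
  have hppd : p + pd = fun n => p (blockStart L n) := by ext n i; simp [hpd]
  set E := ∑ n, v n ⬝ᵥ C n *ᵥ v n with hE
  have hv0 : ∀ n, 0 ≤ v n ⬝ᵥ C n *ᵥ v n := fun n => (hC n).nonneg (hα' n) _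
  -- The excess inequality with no missing neighbor reads e²/β ≤ e, whence e ≤ β.
  have hvb : ∀ n, v n ⬝ᵥ C n *ᵥ v n ≤ β := fun n => by
    have := (hC n).excess (hα' n) hβ hrT (Finset.disjoint_empty_left T) (hpr n) (hCp n) (hg n)
      (hgT n)
    exact QuadBounded.excess_le hβ (by simp) this
  set τ := β * (η ^ 2 * β / α₀ ^ 3) with hτdef
  have hτ0 : 0 < τ := by positivity
  have hpdτ : ∀ n, pd n ⬝ᵥ C n *ᵥ pd n ≤ τ := fun n => by
    refine ((hC n).upper _).trans (mul_le_mul_of_nonneg_left ?_ hβ.le)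
    exact (hC₀ _).regression_sub_le (hC₀ _) hα₀ hη (hCη _ _ (blockStart_div hL n)) (hpr _) (hpr _)
      (hCp _) (hCp _)
  have b1 := h.norm_orthResidual_add_tail (q := q) (f := a) hpS hTS
    (fun n i hi => by rw [(hS i).1 hi]; exact har n) hβ hq hpb L hK
  have b2 := h.norm_orthResidual_add_tail (q := q) (p := v) hgT subset_rfl hg hβ hq hvb L hK
  have b3 := h.sq_lower_tail (q := q) hβ hq hvb hv0
  have b4 := h.linear_tail (q := q) hpS hβ hq hpb
    (c := fun x => WithLp.toLp 2 (linearSeries pd x))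
    (fun x => by
      rw [linearSeries_mask fun n i hi => by rw [(hS i).1 hi]; simp [hpd, hpr]])
    (measurable_toLp_linearSeries pd).norm
    (((measurable_toLp_linearSeries pd).comp measurable_fst).inner
      ((WithLp.measurable_toLp 2 _).comp measurable_snd))
  have b5 := h.sq_upper_tail (q := q) hτ0 hpdτ
  have b0 : P {x | ¬ ∀ b < N / L,
      LinearIndepOn ℝ (blockColumn L x b) (insert r T : Finset (Fin d))} = 0 := by
    rw [← ae_iff]
    have : ∀ᵐ x ∂P, ∀ b : Fin (N / L),
        LinearIndepOn ℝ (blockColumn L x b) (insert r T : Finset (Fin d)) :=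
      ae_all_iff.2 fun b => h.ae_linearIndepOn_blockColumn hα₀ hC₀ b.2 _
        (by rwa [Finset.card_insert_of_notMem hrT])
    filter_upwards [this] with x hx b hb using hx ⟨b, hb⟩
  set δ := ENNReal.ofReal (Real.exp (-q)) with hδ
  -- Singular blocks have probability 0; the two distance bounds fail with probability at most 2δ
  -- each, and the lower tail of v·x, the cross term and the drift energy with probability at most δ
  -- each.
  have hsum : (7 : ℝ≥0∞) * δ = 0 + (2 * δ + (2 * δ + (δ + (δ + δ)))) := by ring
  rw [hsum]
  refine le_trans (measure_mono fun x hx => ?_)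
    ((measure_union_le _ _).trans (add_le_add b0.le
    ((measure_union_le _ _).trans (add_le_add b1
    ((measure_union_le _ _).trans (add_le_add b2
    ((measure_union_le _ _).trans (add_le_add b3
    ((measure_union_le _ _).trans (add_le_add b4 b5))))))))))
  simp only [Set.mem_union, Set.mem_ofPred_eq] at hx ⊢
  by_contra hcon
  push Not at hcon
  obtain ⟨g0, g1, g2, g3, g4, g5⟩ := hcon
  rw [hpa] at g1
  rw [hvg] at g2
  have hlow := norm_orthResidual_sq_le_condVarEst hL hLN x hrT g0
  have hup := condVarEst_le_of_blockStart hL hLN x hrN hpr hp0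
  rw [← hppd, linearSeries_add, WithLp.toLp_add, norm_add_sq_real,
    real_inner_comm] at hup
  set w := ‖orthResidual (blockSpan L T x) (WithLp.toLp 2 (linearSeries a x))‖
  set f := ‖orthResidual (blockSpan L T x) (WithLp.toLp 2 (linearSeries g x))‖
  set y := ‖(WithLp.toLp 2 (linearSeries pd x) : EuclideanSpace ℝ (Fin N))‖
  -- The common term ‖p·x‖² of the lower bound for T and the upper bound for the neighborhood
  -- cancels here.
  have hD : w ^ 2 - 2 * √(2 * β * q) * w - 4 * β * (K + q) - y ^ 2 - 2 * √(2 * β * q) * y ≤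
      N * condVarEst L x r T - N * condVarEst L x r Nb := by linarith
  -- Whatever the distance f of g·x from the span, f² - 2f√(2βq) ≥ -2βq, so the variation of g
  -- within blocks does no harm.
  have hw : ‖(WithLp.toLp 2 (linearSeries v x) : EuclideanSpace ℝ (Fin N))‖ ^ 2 -
      4 * β * (K + q) - 2 * β * q ≤ w ^ 2 := by
    have hs : √(2 * β * q) ^ 2 = 2 * β * q := Real.sq_sqrt (by positivity)
    nlinarith [sq_nonneg (f - √(2 * β * q))]
  have hcard : (T.card : ℝ) - Nb.card = (T \ Nb).card - (Nb \ T).card := by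
    have h1 := Finset.card_sdiff_add_card_inter T Nb
    have h2 := Finset.card_sdiff_add_card_inter Nb T
    rw [Finset.inter_comm Nb T] at h2
    rw [← h1, ← h2]; push_cast; ring
  have hle : N * condVarEst L x r T - N * condVarEst L x r Nb ≤
      N * ρ * ((Nb \ T).card - (T \ Nb).card) := by
    have h1 : T.card * ρ - Nb.card * ρ = ρ * ((T \ Nb).card - (Nb \ T).card) := by
      rw [← sub_mul, hcard, mul_comm]
    have h2 : condVarEst L x r T - condVarEst L x r Nb ≤
        ρ * ((Nb \ T).card - (T \ Nb).card) := by linarith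
    have h3 := mul_le_mul_of_nonneg_left h2 hN'.le
    linarith
  -- Without missing neighbors T has at least one superfluous node, and its penalty Nρ beats the
  -- errors. Otherwise the excess variance beats the penalty saved by the missing nodes, and
  -- superfluous nodes only help.
  rcases (Nb \ T).eq_empty_or_nonempty with h0 | hne
  · have hk : 1 ≤ ((T \ Nb).card : ℝ) := by
      have : (T \ Nb).Nonempty := by
        rw [Finset.sdiff_nonempty]
        intro hsub
        exact hTN (Finset.Subset.antisymm hsub (Finset.sdiff_eq_empty_iff_subset.1 h0))
      exact_mod_cast this.card_pos
    have := margin_of_superset hβ hε hεβ hN' hρ hρβ hq hqN hqN' hKN hτ0.le hτ g5 hD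
    rw [h0, Finset.card_empty, Nat.cast_zero, zero_sub] at hle
    have h4 := mul_le_mul_of_nonneg_left hk (mul_pos hN' hρ).le
    linarith
  · have hm : 1 ≤ ((Nb \ T).card : ℝ) := by exact_mod_cast hne.card_pos
    have hexc := sum_excess (E := E) hβ hN hα' hC hrT (M := Nb \ T)
      (fun hr => hrN (Finset.mem_sdiff.1 hr).1) Finset.sdiff_disjoint
      (fun j hj => hρNb j (Finset.mem_sdiff.1 hj).1) hg hgT rfl
    have := margin_of_missing hβ hε hεβ hN' hρ hq hqN hqN' hK0 hKN hτ0.le hτ g5 hD hexc hm g3 hw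
    have h4 := mul_nonneg (mul_pos hN' hρ).le (Nat.cast_nonneg (α := ℝ) (T \ Nb).card)
    linarith

end IsUncorrelatedGaussian

end SelectionError

/-! ### Graph output, choice of the constants and the union bound. -/

section Combination

open scoped ENNReal NNReal Matrix

variable {N d : ℕ}

theorem card_filter_card_le (hd : 2 ≤ d) (s : ℕ) :
    (Finset.univ.filter fun T : Finset (Fin d) => T.card ≤ s).card ≤ d ^ (s + 1) := by
  have h1 : (Finset.univ.filter fun T : Finset (Fin d) => T.card ≤ s) ⊆
      (Finset.range (s + 1)).biUnion fun t => Finset.powersetCard t Finset.univ := by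
    intro T hT
    rw [Finset.mem_filter] at hT
    simp [Finset.mem_powersetCard]
    omega
  calc _ ≤ ∑ t ∈ Finset.range (s + 1), (Finset.powersetCard t (Finset.univ : Finset (Fin d))).card :=
        (Finset.card_le_card h1).trans Finset.card_biUnion_le
    _ ≤ ∑ t ∈ Finset.range (s + 1), d ^ t := by
        refine Finset.sum_le_sum fun t _ => ?_
        rw [Finset.card_powersetCard, Finset.card_univ, Fintype.card_fin]
        exact Nat.choose_le_pow d t
    _ ≤ _ := (Nat.geomSum_lt hd fun t ht => Finset.mem_range.1 ht).le

theorem CombineRule.graph_neighbors (rule : CombineRule) (G : SimpleGraph (Fin d))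
    {Nb : Fin d → Finset (Fin d)} (hNb : ∀ r j, j ∈ Nb r ↔ G.Adj r j) : rule.graph Nb = G := by
  ext i j
  cases rule
  · simp only [CombineRule.graph, SimpleGraph.fromRel_adj, hNb]
    exact ⟨fun h => h.2.elim id fun h => h.symm, fun h => ⟨h.ne, Or.inl h⟩⟩
  · simp only [CombineRule.graph, hNb]
    exact ⟨fun h => h.2.1, fun h => ⟨h.ne, h, h.symm⟩⟩

/-- Strict inequality against every competitor makes the minimizer unique, so tie-breaking is
vacuous, and symmetry of adjacency makes both rules return the same graph. -/
theorem isGMSOutput_iff {s L : ℕ} {ρ : ℝ} {x : Fin N → Fin d → ℝ} (rule : CombineRule)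
    {G : SimpleGraph (Fin d)} {Nb : Fin d → Finset (Fin d)} (hNb : ∀ r j, j ∈ Nb r ↔ G.Adj r j)
    (hs : ∀ r, (Nb r).card ≤ s)
    (hx : ∀ r, ∀ T ∈ candidateSets s r, T ≠ Nb r →
      condVarEst L x r (Nb r) + (Nb r).card * ρ < condVarEst L x r T + T.card * ρ)
    (H : SimpleGraph (Fin d)) : IsGMSOutput rule s L ρ x H ↔ H = G := by
  have hcand : ∀ r, Nb r ∈ candidateSets s r := fun r =>
    ⟨fun h => ((hNb r r).1 h).ne rfl, hs r⟩
  have hmin : ∀ r, IsNeighborhoodEstimate s L ρ x r (Nb r) := fun r =>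
    ⟨hcand r, fun T hT => by
      by_cases hTN : T = Nb r
      · rw [hTN]
      · exact (hx r T hT hTN).le⟩
  have huniq : ∀ r T, IsNeighborhoodEstimate s L ρ x r T → T = Nb r := fun r T hT => by
    by_contra hTN
    exact absurd (hT.2 _ (hcand r)) (not_le.2 (hx r T hT.1 hTN))
  constructor
  · rintro ⟨Nh, hNh, rfl⟩
    rw [show Nh = Nb from funext fun r => huniq r _ (hNh r), rule.graph_neighbors G hNb]
  · rintro rfl
    exact ⟨Nb, hmin, (rule.graph_neighbors H hNb).symm⟩

theorem isGMSOutput_of_subsingleton [Subsingleton (Fin d)] {s L : ℕ} {ρ : ℝ}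
    (x : Fin N → Fin d → ℝ) (rule : CombineRule) (H : SimpleGraph (Fin d)) :
    IsGMSOutput rule s L ρ x H := by
  refine ⟨fun _ => ∅, fun r => ⟨⟨Finset.notMem_empty r, by simp⟩, fun T hT => ?_⟩, ?_⟩
  · have : T = ∅ := Finset.eq_empty_of_forall_notMem fun i hi =>
      hT.1 (Subsingleton.elim i r ▸ hi)
    rw [this]
  · ext i j
    simp [Subsingleton.elim i j]

/-- A single squared coefficient is at most the squared norm of the residual vector, and α times
that norm is at most β. -/
theorem partialCorr_le {C : Fin N → Matrix (Fin d) (Fin d) ℝ} {α : Fin N → ℝ} {β : ℝ} (hN : 0 < N)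
    (hα : ∀ n, 0 < α n) (hC : ∀ n, QuadBounded (C n) (α n) β) (a b : Fin d) :
    partialCorr α C a b ≤ β := by
  have hN' : (0 : ℝ) < N := by exact_mod_cast hN
  have h1 : ∀ n, α n * ((C n)⁻¹ a b / (C n)⁻¹ a a) ^ 2 ≤ β := fun n => by
    have h2 := ((hC n).regression_norm_le (hα n) ((hC n).residualCoeff_self (hα n) a)
      ((hC n).mulVec_residualCoeff (hα n) a)).2.2
    refine le_trans (mul_le_mul_of_nonneg_left ?_ (hα n).le) h2
    rw [dotProduct_self_eq_sum_sq]
    exact Finset.single_le_sum (f := fun j => residualCoeff (C n) a j ^ 2)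
      (fun j _ => sq_nonneg _) (Finset.mem_univ b)
  rw [partialCorr, one_div_mul_eq_div, div_le_iff₀ hN']
  refine (Finset.sum_le_sum fun n _ => h1 n).trans_eq ?_
  simp [mul_comm]

theorem sum_abs_row_le_maxRowSum (A : Matrix (Fin d) (Fin d) ℝ) (i : Fin d) :
    ∑ j, |A i j| ≤ maxRowSum A :=
  le_ciSup (f := fun i => ∑ j, |A i j|) (Set.finite_range _).bddAbove i

theorem maxRowSum_block_le {C : Fin N → Matrix (Fin d) (Fin d) ℝ} {κ : ℝ} (hκ : 0 < κ) {L : ℕ}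
    (hL : 0 < L) (hC : ∀ n₁ n₂ : Fin N, maxRowSum (C n₁ - C n₂) ≤
      κ * (|((n₂ : ℕ) : ℝ) - ((n₁ : ℕ) : ℝ)| / (N : ℝ))) {n n' : Fin N}
    (h : n.val / L = n'.val / L) (i : Fin d) : ∑ j, |(C n - C n') i j| ≤ κ * (L / N) := by
  refine (sum_abs_row_le_maxRowSum _ i).trans ((hC n n').trans ?_)
  have h1 := Nat.div_add_mod n.val L
  have h2 := Nat.div_add_mod n'.val L
  have h3 := Nat.mod_lt n.val hL
  have h4 := Nat.mod_lt n'.val hL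
  rw [h] at h1
  have h5 : |((n' : ℕ) : ℝ) - ((n : ℕ) : ℝ)| ≤ L := by
    rw [abs_le]
    constructor
    · have : (n : ℕ) ≤ n' + L := by omega
      have : ((n : ℕ) : ℝ) ≤ n' + L := by exact_mod_cast this
      linarith
    · have : (n' : ℕ) ≤ n + L := by omega
      have : ((n' : ℕ) : ℝ) ≤ n + L := by exact_mod_cast this
      linarith
  gcongr

set_option maxHeartbeats 1000000 in
/-- The numerical consequences of the choice of blocklength and sample size. -/
theorem sample_size_bounds {α₀ β ε c₁ c₂ : ℝ} (hα₀ : 0 < α₀) (hβ : 0 < β) (hε : 0 < ε)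
    (hεβ : ε * β ^ 3 ≤ 1) (hc₂ : c₂ = 2 / ε + 4 * β ^ 2)
    (hc₁ : c₁ = 6 / ε + (c₂ + 2 * β ^ 2) * (1 + β ^ 2 / (α₀ ^ 3 * ε)))
    {N s L : ℕ} {ρ κ Q : ℝ} (hs : 1 ≤ s) (hρ : 0 < ρ) (hρβ : ρ ≤ β) (hκ : 0 < κ) (hQ : 1 / 2 ≤ Q)
    (hL : L = ⌈c₂ * ((s : ℝ) ^ 2 / ρ ^ 2) * Q⌉₊) (hLN : L ∣ N)
    (hN : c₁ * max 1 κ * ((s : ℝ) ^ (5 / 2 : ℝ) / ρ ^ 3) * Q ≤ N) :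
    s + 1 ≤ L ∧ 6 * Q ≤ ε * ρ ^ 3 * N ∧ 6 * Q ≤ N ∧
      ((N / L * s : ℕ) : ℝ) ≤ ε * ρ ^ 2 * N ∧
      β * ((κ * (L / N)) ^ 2 * β / α₀ ^ 3) ≤ ε * ρ ^ 2 := by
  have hs' : (1 : ℝ) ≤ s := by exact_mod_cast hs
  have hQ0 : 0 < Q := by linarith
  have hc₂0 : 0 < c₂ := by rw [hc₂]; positivity
  set X := 1 + β ^ 2 / (α₀ ^ 3 * ε) with hX
  have hX0 : 0 < X := by positivity
  have hc₁0 : 0 < c₁ := by rw [hc₁]; positivity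
  set S := (s : ℝ) ^ (5 / 2 : ℝ) with hS
  have hSs : (s : ℝ) ^ 2 ≤ S := by
    rw [hS, ← Real.rpow_natCast]
    exact Real.rpow_le_rpow_of_exponent_le hs' (by norm_num)
  have hS1 : 1 ≤ S := le_trans (by nlinarith) hSs
  have hS0 : 0 < S := by linarith
  have hL1 : c₂ * ((s : ℝ) ^ 2 / ρ ^ 2) * Q ≤ L := by rw [hL]; exact Nat.le_ceil _
  have hL2 : (L : ℝ) ≤ c₂ * ((s : ℝ) ^ 2 / ρ ^ 2) * Q + 1 := by
    rw [hL]; exact (Nat.ceil_lt_add_one (by positivity)).le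
  have hρs : 1 / β ^ 2 ≤ (s : ℝ) ^ 2 / ρ ^ 2 := by
    rw [div_le_div_iff₀ (by positivity) (by positivity)]
    have : ρ ^ 2 ≤ β ^ 2 := by gcongr
    have h1 : (1 : ℝ) ≤ (s : ℝ) ^ 2 := one_le_pow₀ hs'
    gcongr
  set R := (s : ℝ) ^ 2 / ρ ^ 2 with hR
  have hR0 : 0 < R := by positivity
  have hN1 : c₁ * (S / ρ ^ 3) * Q ≤ N := by
    refine le_trans ?_ hN
    have : c₁ * 1 ≤ c₁ * max 1 κ := by gcongr; exact le_max_left _ _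
    rw [mul_one] at this
    gcongr
  have hN2 : c₁ * κ * (S / ρ ^ 3) * Q ≤ N := by
    refine le_trans ?_ hN
    gcongr
    exact le_max_right _ _
  have hN0 : (0 : ℝ) < N := lt_of_lt_of_le (by positivity) hN1
  have hq1 : 6 * Q ≤ ε * ρ ^ 3 * N := by
    have h1 : c₁ * (1 / ρ ^ 3) * Q ≤ N := le_trans (by gcongr) hN1
    have h2 : 6 ≤ ε * c₁ := by
      rw [hc₁, mul_add, mul_div_cancel₀ _ hε.ne']
      have : 0 ≤ ε * ((c₂ + 2 * β ^ 2) * X) := by positivity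
      linarith
    calc 6 * Q ≤ ε * c₁ * Q := by gcongr
      _ = ε * ρ ^ 3 * (c₁ * (1 / ρ ^ 3) * Q) := by field_simp
      _ ≤ _ := by gcongr
  have hLpos : (0 : ℝ) < L := lt_of_lt_of_le (by positivity) hL1
  refine ⟨?_, hq1, ?_, ?_, ?_⟩
  -- The summand 4β² of c₂ makes blocks longer than s + 1, as nonsingularity requires.
  · have h1 : 2 * (s : ℝ) ^ 2 ≤ L := by
      refine le_trans ?_ hL1
      have h2 : 4 * β ^ 2 ≤ c₂ := by
        rw [hc₂]; have : 0 < 2 / ε := by positivity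
        linarith
      calc 2 * (s : ℝ) ^ 2 = 4 * β ^ 2 * ((s : ℝ) ^ 2 / β ^ 2) * (1 / 2) := by field_simp; norm_num
        _ ≤ c₂ * ((s : ℝ) ^ 2 / ρ ^ 2) * Q := by gcongr
    have h2 : ((s + 1 : ℕ) : ℝ) ≤ L := by push_cast; nlinarith
    exact_mod_cast h2
  · have h1 : ε * ρ ^ 3 ≤ 1 := le_trans (by gcongr) hεβ
    calc 6 * Q ≤ ε * ρ ^ 3 * N := hq1
      _ ≤ 1 * N := by gcongr
      _ = N := one_mul _
  -- The summand 2/ε of c₂ controls the dimension of the span; the 2 compensates for Q ≥ 1/2.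
  · have h1 : (s : ℝ) ≤ ε * ρ ^ 2 * L := by
      have h2 : 2 / ε ≤ c₂ := by
        rw [hc₂]; have : 0 < 4 * β ^ 2 := by positivity
        linarith
      calc (s : ℝ) ≤ (s : ℝ) ^ 2 := by nlinarith
        _ = ε * ρ ^ 2 * (2 / ε * R * (1 / 2)) := by rw [hR]; field_simp
        _ ≤ ε * ρ ^ 2 * (c₂ * R * Q) := by gcongr
        _ ≤ _ := by gcongr
    have h3 : ((N / L : ℕ) : ℝ) * L = N := by exact_mod_cast Nat.div_mul_cancel hLN
    push_cast
    calc ((N / L : ℕ) : ℝ) * s ≤ ((N / L : ℕ) : ℝ) * (ε * ρ ^ 2 * L) := by gcongr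
      _ = ε * ρ ^ 2 * (((N / L : ℕ) : ℝ) * L) := by ring
      _ = _ := by rw [h3]
  -- The extra 2β² absorbs the 1 lost to rounding up L.
  · have hL3 : (L : ℝ) ≤ (c₂ + 2 * β ^ 2) * R * Q := by
      have h1 : 1 ≤ 2 * β ^ 2 * R * Q := by
        calc (1 : ℝ) = 2 * β ^ 2 * (1 / β ^ 2) * (1 / 2) := by field_simp
          _ ≤ _ := by gcongr
      linarith
    -- The second summand of c₁ is designed for this bound on the variation of C within a block; X
    -- is chosen so that X² ≥ β²/(α₀³ε), which turns it into the required drift bound.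
    have hη : κ * (L / N) ≤ ρ / X := by
      rw [← mul_div_assoc, div_le_div_iff₀ hN0 hX0]
      have h2 : (c₂ + 2 * β ^ 2) * X ≤ c₁ := by
        rw [hc₁]; have : 0 < 6 / ε := by positivity
        linarith
      calc κ * L * X ≤ κ * ((c₂ + 2 * β ^ 2) * R * Q) * X := by gcongr
        _ = ((c₂ + 2 * β ^ 2) * X) * κ * R * Q := by ring
        _ ≤ c₁ * κ * R * Q := by gcongr
        _ ≤ c₁ * κ * (S / ρ ^ 2) * Q := by rw [hR]; gcongr
        _ = ρ * (c₁ * κ * (S / ρ ^ 3) * Q) := by field_simp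
        _ ≤ ρ * N := by gcongr
    have hX1 : β ^ 2 / (α₀ ^ 3 * ε) ≤ X ^ 2 := by
      have h0 : 0 ≤ β ^ 2 / (α₀ ^ 3 * ε) := by positivity
      have h1 : X ≤ X ^ 2 := le_self_pow₀ (by linarith) two_ne_zero
      linarith
    have hη0 : 0 ≤ κ * (L / N) := by positivity
    calc β * ((κ * (L / N)) ^ 2 * β / α₀ ^ 3) ≤ β * ((ρ / X) ^ 2 * β / α₀ ^ 3) := by gcongr
      _ = ε * ρ ^ 2 * (β ^ 2 / (α₀ ^ 3 * ε)) / X ^ 2 := by field_simp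
      _ ≤ ε * ρ ^ 2 * X ^ 2 / X ^ 2 := by gcongr
      _ = _ := by field_simp

/-- For d ≥ 2 one has log d > 1/2. The factor 6 in the exponent suffices because 7d^(s+2) ≤ d^(s+5)
≤ d^(6s) for s ≥ 1. -/
theorem log_two_le_complexityFactor {s : ℕ} {κ ρ δ : ℝ} (hd : 2 ≤ d) (hs : 1 ≤ s)
    (hρ : 0 < ρ) (hδ : 0 < δ) (hδ1 : δ < 1) (hκρ : ρ ^ 3 ≤ κ * (s : ℝ) ^ (7 / 2 : ℝ)) :
    1 / 2 ≤ complexityFactor d s κ ρ δ ∧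
      7 * (d : ℝ) ^ (s + 2) * Real.exp (-(6 * complexityFactor d s κ ρ δ)) ≤ δ := by
  have hs' : (1 : ℝ) ≤ s := by exact_mod_cast hs
  have hd' : (2 : ℝ) ≤ d := by exact_mod_cast hd
  have hlogd : 1 / 2 ≤ Real.log d := by
    have h1 := Real.log_two_gt_d9
    have h2 := Real.log_le_log two_pos hd'
    linarith
  have h1 : Real.log (1 / δ) ≤ Real.log (κ * (s : ℝ) ^ (7 / 2 : ℝ) / (δ * ρ ^ 3)) := by
    refine Real.log_le_log (by positivity) ?_
    rw [div_le_div_iff₀ hδ (by positivity), one_mul]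
    nlinarith
  have h2 : 0 < Real.log (1 / δ) := Real.log_pos (by rw [lt_div_iff₀ hδ]; linarith)
  have h3 : Real.log d ≤ s * Real.log d := by nlinarith
  rw [complexityFactor]
  set Q := Real.log (κ * (s : ℝ) ^ (7 / 2 : ℝ) / (δ * ρ ^ 3)) + s * Real.log d with hQ
  have h4 : Real.log (1 / δ) = -Real.log δ := by rw [one_div, Real.log_inv]
  refine ⟨by linarith, ?_⟩
  have h5 : -(6 * Q) ≤ Real.log δ - (6 * s : ℕ) * Real.log d := by
    push_cast
    nlinarith
  have h6 : Real.exp (-(6 * Q)) ≤ δ / d ^ (6 * s) := by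
    refine (Real.exp_le_exp.2 h5).trans_eq ?_
    rw [Real.exp_sub, Real.exp_log hδ, mul_comm ((6 * s : ℕ) : ℝ), Real.exp_mul,
      Real.exp_log (by linarith), Real.rpow_natCast]
  have h7 : 7 * (d : ℝ) ^ (s + 2) ≤ d ^ (6 * s) := by
    have h8 : (7 : ℝ) ≤ d ^ 3 := by
      calc (7 : ℝ) ≤ 2 ^ 3 := by norm_num
        _ ≤ _ := by gcongr
    calc 7 * (d : ℝ) ^ (s + 2) ≤ d ^ 3 * d ^ (s + 2) := by gcongr
      _ = d ^ (s + 5) := by ring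
      _ ≤ _ := pow_le_pow_right₀ (by linarith) (by omega)
  have hdp : (0 : ℝ) < d ^ (6 * s) := by positivity
  calc _ ≤ (d : ℝ) ^ (6 * s) * (δ / d ^ (6 * s)) := by gcongr
    _ = δ := by field_simp

end Combination

/-! ### The recovery guarantee. -/

theorem theorem2 (α₀ β₀ : ℝ) (hα₀ : 0 < α₀) (hαβ₀ : α₀ ≤ β₀) :
    ∃ c₁ c₂ : ℝ, 0 < c₁ ∧ 0 < c₂ ∧
      ∀ (N d s L : ℕ) (α β : Fin N → ℝ) (C : Fin N → Matrix (Fin d) (Fin d) ℝ) (κ ρmin δ : ℝ)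
        (rule : CombineRule)
        (Ω : Type*) [MeasurableSpace Ω] (μ : Measure Ω) [IsProbabilityMeasure μ]
        (X : Ω → Fin N → Fin d → ℝ),
        1 ≤ s → 0 < κ → 0 < ρmin → 0 < δ → δ < 1 →
        -- the process: jointly Gaussian, zero mean, uncorrelated over time, covariances `C n`
        HasGaussianLaw X μ →
        (∀ n i, ∫ ω, X ω n i ∂μ = 0) →
        (∀ n n' i j, ∫ ω, X ω n i * X ω n' j ∂μ = if n = n' then C n i j else 0) →
        -- eigenvalue bounds
        (∀ n, α₀ ≤ α n ∧ α n ≤ β n ∧ β n ≤ β₀) →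
        (∀ n, spectrum ℝ (C n) ⊆ Set.Icc (α n) (β n)) →
        -- minimum partial correlation
        (∀ a b, (condIndepGraph (μ.map X)).Adj a b → ρmin ≤ partialCorr α C a b) →
        (condIndepGraph (μ.map X) = ⊥ → ρmin ≤ (1 / (N : ℝ)) * ∑ n, β n) →
        -- sparsity
        (∀ r, ((condIndepGraph (μ.map X)).neighborSet r).ncard ≤ s) →
        -- slowly varying covariance
        (∀ n₁ n₂ : Fin N, maxRowSum (C n₁ - C n₂) ≤
          κ * (|((n₂ : ℕ) : ℝ) - ((n₁ : ℕ) : ℝ)| / (N : ℝ))) →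
        ρmin ^ 3 ≤ κ * (s : ℝ) ^ (7 / 2 : ℝ) →
        -- blocklength and sample size
        L = ⌈c₂ * ((s : ℝ) ^ 2 / ρmin ^ 2) * complexityFactor d s κ ρmin δ⌉₊ →
        L ∣ N →
        c₁ * max 1 κ * ((s : ℝ) ^ (5 / 2 : ℝ) / ρmin ^ 3) * complexityFactor d s κ ρmin δ
          ≤ (N : ℝ) →
        ENNReal.ofReal (1 - δ) ≤
          μ {ω | ∀ H : SimpleGraph (Fin d),
            IsGMSOutput rule s L ρmin (X ω) H ↔ H = condIndepGraph (μ.map X)} := by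
  classical
  have hβ₀ : 0 < β₀ := hα₀.trans_le hαβ₀
  -- The largest ε that the accounting of errors in `margin_of_missing` allows.
  set ε : ℝ := 1 / (2 * β₀ * (36 * β₀ ^ 2 + 8 * β₀ + 16)) with hεdef
  have hε : 0 < ε := by positivity
  have hεβ : ε * β₀ * (36 * β₀ ^ 2 + 8 * β₀ + 16) = 1 / 2 := by
    rw [hεdef]; field_simp
  have hεβ3 : ε * β₀ ^ 3 ≤ 1 := by
    have h1 : 0 ≤ ε * β₀ * (35 * β₀ ^ 2 + 8 * β₀ + 16) := by positivity
    nlinarith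
  obtain ⟨c₂, hc₂⟩ : ∃ c₂, c₂ = 2 / ε + 4 * β₀ ^ 2 := ⟨_, rfl⟩
  obtain ⟨c₁, hc₁⟩ : ∃ c₁, c₁ = 6 / ε + (c₂ + 2 * β₀ ^ 2) * (1 + β₀ ^ 2 / (α₀ ^ 3 * ε)) := ⟨_, rfl⟩
  have hc₂0 : 0 < c₂ := by rw [hc₂]; positivity
  refine ⟨c₁, c₂, by rw [hc₁]; positivity, hc₂0, ?_⟩
  intro N d s L α β C κ ρmin δ rule Ω _ μ _ X hs hκ hρ hδ hδ1 hX hmean hcov hαβ hspec hpc hbot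
    hdeg hvar hκρ hL hLN hNge
  -- For d ≤ 1 only one graph exists and every output is correct. This case is separate because log
  -- d = 0 there, so the lower bound on Q may fail.
  rcases lt_or_ge d 2 with hd | hd
  · have : Subsingleton (Fin d) := Fin.subsingleton_iff_le_one.2 (by omega)
    have huniv : {ω | ∀ H : SimpleGraph (Fin d),
        IsGMSOutput rule s L ρmin (X ω) H ↔ H = condIndepGraph (μ.map X)} = Set.univ := by
      refine Set.eq_univ_of_forall fun ω H => ?_
      refine iff_of_true (isGMSOutput_of_subsingleton _ _ _) ?_
      ext i j
      simp [Subsingleton.elim i j]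
    rw [huniv, measure_univ]
    exact ENNReal.ofReal_le_one.2 (by linarith)
  obtain ⟨hQ, hfail⟩ := log_two_le_complexityFactor hd hs hρ hδ hδ1 hκρ
  set Q := complexityFactor d s κ ρmin δ with hQdef
  set P := μ.map X with hP
  have hXm : AEMeasurable X μ := hX.aemeasurable
  have hcoord : ∀ n i, Measurable fun x : Fin N → Fin d → ℝ => x n i := fun n i =>
    (measurable_pi_apply i).comp (measurable_pi_apply n)
  have h : IsUncorrelatedGaussian P C :=
    { gaussian := hX.isGaussian_map
      mean := fun n i => by
        rw [hP, integral_map hXm (hcoord n i).aestronglyMeasurable]; exact hmean n i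
      cov := fun n n' i j => by
        have hm : Measurable fun x : Fin N → Fin d → ℝ => x n i * x n' j :=
          (hcoord n i).mul (hcoord n' j)
        rw [hP, integral_map hXm hm.aestronglyMeasurable]
        exact hcov n n' i j }
  have hα : ∀ n, α₀ ≤ α n := fun n => (hαβ n).1
  have hα0 : ∀ n, 0 < α n := fun n => hα₀.trans_le (hα n)
  have hC : ∀ n, QuadBounded (C n) (α n) β₀ := fun n =>
    (QuadBounded.of_spectrum (h.cov_isSymm n) (hspec n)).mono le_rfl (hαβ n).2.2
  have hN0 : 0 < N := by
    have h1 : (0 : ℝ) < N := by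
      have : 0 < c₁ := by rw [hc₁]; positivity
      have hs0 : (0 : ℝ) < s := by exact_mod_cast hs
      have h2 : 0 < Q := by linarith
      have h3 : 0 < max 1 κ := lt_max_of_lt_left one_pos
      refine lt_of_lt_of_le ?_ hNge
      positivity
    exact_mod_cast h1
  set G := condIndepGraph P with hG
  -- For an empty graph no edge bounds ρmin, and the extra clause of assumption (i) takes over.
  have hρβ : ρmin ≤ β₀ := by
    by_cases hGbot : G = ⊥
    · refine (hbot hGbot).trans ?_
      have hN' : (0 : ℝ) < N := by exact_mod_cast hN0
      rw [one_div_mul_eq_div, div_le_iff₀ hN']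
      refine (Finset.sum_le_sum fun n _ => (hαβ n).2.2).trans_eq ?_
      simp [mul_comm]
    · obtain ⟨a, b, hab⟩ := SimpleGraph.ne_bot_iff_exists_adj.1 hGbot
      exact (hpc a b hab).trans (partialCorr_le hN0 hα0 hC a b)
  obtain ⟨hsL, hq1, hq2, hK, hτ⟩ := sample_size_bounds hα₀ hβ₀ hε hεβ3 hc₂ hc₁ hs hρ hρβ hκ hQ hL
    hLN hNge
  have hLpos : 0 < L := by omega
  let Nb : Fin d → Finset (Fin d) := fun r => Finset.univ.filter fun j => G.Adj r j
  have hNb : ∀ r j, j ∈ Nb r ↔ G.Adj r j := fun r j => by simp [Nb]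
  have hNbs : ∀ r, (Nb r).card ≤ s := fun r => by
    refine le_of_eq_of_le ?_ (hdeg r)
    rw [← Set.ncard_coe_finset]
    congr 1
    ext j
    simp [hNb]
  have hinv : ∀ r n j, j ≠ r → j ∉ Nb r → (C n)⁻¹ r j = 0 := by
    intro r n j hjr hj
    rw [hNb] at hj
    have hci : ComponentsCondIndep P ({r, j}ᶜ) r j := by
      by_contra hci
      exact hj ⟨hjr.symm, hci⟩
    exact h.inv_apply_eq_zero_of_condIndep hjr.symm hci n (hα0 n) (hC n)
  let Bad : Fin d → Finset (Fin d) → Set (Fin N → Fin d → ℝ) := fun r T =>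
    {x | condVarEst L x r T + T.card * ρmin ≤ condVarEst L x r (Nb r) + (Nb r).card * ρmin}
  have hbad : ∀ r T, T ∈ candidateSets s r → T ≠ Nb r →
      P (Bad r T) ≤ 7 * ENNReal.ofReal (Real.exp (-(6 * Q))) := by
    intro r T hT hTN
    have hN' : (0 : ℝ) < N := by exact_mod_cast hN0
    have hL' : (0 : ℝ) < L := by exact_mod_cast hLpos
    exact h.selection_error_le (η := κ * (L / N)) (K := ((N / L * s : ℕ) : ℝ)) hα₀ hα hβ₀ hC
      (fun hr => ((hNb r r).1 hr).ne rfl) (fun n j => hinv r n j)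
      (fun j hj => hpc r j ((hNb r j).1 hj)) hT.1 hTN hN0 hLpos hLN (by have := hT.2; omega)
      (by positivity) (fun n n' hnn i => maxRowSum_block_le hκ hLpos hvar hnn i) hε hεβ.le hρ hρβ
      (by linarith) hq1 hq2 (by exact_mod_cast Nat.mul_le_mul_left _ hT.2) hK hτ
  set F : Finset (Finset (Fin d)) := Finset.univ.filter fun T => T.card ≤ s with hF
  set B : Set (Fin N → Fin d → ℝ) :=
    ⋃ r ∈ (Finset.univ : Finset (Fin d)), ⋃ T ∈ F.filter fun T => r ∉ T ∧ T ≠ Nb r, Bad r T with hB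
  have hPB : P B ≤ ENNReal.ofReal δ := by
    calc P B ≤ ∑ r : Fin d, ∑ T ∈ F.filter fun T => r ∉ T ∧ T ≠ Nb r, P (Bad r T) :=
          (measure_biUnion_finset_le _ _).trans
            (Finset.sum_le_sum fun r _ => measure_biUnion_finset_le _ _)
      _ ≤ ∑ r : Fin d, ∑ T ∈ F, 7 * ENNReal.ofReal (Real.exp (-(6 * Q))) := by
          refine Finset.sum_le_sum fun r _ => ?_
          refine (Finset.sum_le_sum fun T hT => ?_).trans
            (Finset.sum_le_sum_of_subset (Finset.filter_subset _ _))
          rw [Finset.mem_filter, hF, Finset.mem_filter] at hT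
          exact hbad r T ⟨hT.2.1, hT.1.2⟩ hT.2.2
      _ = ENNReal.ofReal (d * F.card * (7 * Real.exp (-(6 * Q)))) := by
          rw [Finset.sum_const, Finset.sum_const, Finset.card_univ, Fintype.card_fin,
            nsmul_eq_mul, nsmul_eq_mul, ENNReal.ofReal_mul (by positivity),
            ENNReal.ofReal_mul (by positivity), ENNReal.ofReal_mul (by norm_num),
            ENNReal.ofReal_natCast, ENNReal.ofReal_natCast, mul_assoc]
          norm_num
      _ ≤ ENNReal.ofReal δ := by
          refine ENNReal.ofReal_le_ofReal (le_trans ?_ hfail)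
          have hcard : (F.card : ℝ) ≤ (d : ℝ) ^ (s + 1) := by
            exact_mod_cast card_filter_card_le hd s
          calc (d : ℝ) * F.card * (7 * Real.exp (-(6 * Q)))
              ≤ d * (d : ℝ) ^ (s + 1) * (7 * Real.exp (-(6 * Q))) := by gcongr
            _ = _ := by ring
  have hgood : ∀ ω, X ω ∉ B → ∀ H : SimpleGraph (Fin d),
      IsGMSOutput rule s L ρmin (X ω) H ↔ H = G := by
    intro ω hω
    refine isGMSOutput_iff rule hNb hNbs fun r T hT hTN => ?_
    by_contra hle
    refine hω ?_
    simp only [hB, Set.mem_iUnion]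
    exact ⟨r, Finset.mem_univ r, T, by simp [hF, hT.1, hT.2, hTN], not_lt.1 hle⟩
  -- Measurability of B is not needed: passing from the law of X to a preimage is an inequality in
  -- the right direction for every set.
  have hμB : μ {ω | X ω ∈ B} ≤ ENNReal.ofReal δ := by
    refine le_trans ?_ hPB
    have h1 := Measure.le_map_apply hXm B
    exact h1
  -- Subadditivity of the covering by the bad and good events replaces a complement, which would
  -- require measurability.
  have htot : (1 : ENNReal) ≤ μ {ω | X ω ∈ B} + μ {ω | ∀ H : SimpleGraph (Fin d),
      IsGMSOutput rule s L ρmin (X ω) H ↔ H = G} := by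
    rw [← measure_univ (μ := μ)]
    refine (measure_mono fun ω _ => ?_).trans (measure_union_le _ _)
    by_cases hω : X ω ∈ B
    · exact Or.inl hω
    · exact Or.inr (hgood ω hω)
  rw [ENNReal.ofReal_sub _ hδ.le, ENNReal.ofReal_one]
  exact tsub_le_iff_left.2 (htot.trans (add_le_add_left hμB _))
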